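/- **Theorem.** Let $0<y<1$ and let $u:[0,\infty)\to(0,\infty)$ satisfy * **A1.** $\psi(x)=x\,u(x)$ is strictly increasing on $[0,\infty)$ and $\lim_{x\to\infty}\psi(x)>y$ (the limit may be $+\infty$); * **A2.** $u$ is twice differentiable on $[0,\infty)$ and $x\,u'(x)<u(x)$ for all $x\ge 0$. For $\boldsymbol x_1,\dots,\boldsymbol x_n\in\mathbb R^p$, Maronna's M-estimator $\bar\Sigma$ is the positive definite $p\times p$ matrix solving $$\bar\Sigma=\sum_{i=1}^n u\big(\boldsymbol x_i^T\bar\Sigma^{-1}\boldsymbol x_i\big)\,\boldsymbol x_i\boldsymbol x_i^T ,$$ and $\boldsymbol S_n=\frac1n\sum_{i=1}^n\boldsymbol x_i\boldsymbol x_i^T$. Let $\psi^{-1}(y)$ be the unique $w\ge 0$ with $w\,u(w)=y$, and let $\|\cdot\|$ be the operator norm. In both parts $\boldsymbol x_1,\dots,\boldsymbol x_n$ are i.i.d. $N(\mathbf 0,\mathbf I)$ in $\mathbb R^p$. 1. (Almost sure convergence.) Let $p=p_n$ with $p_n/n\to y$, and for each $n$ let a sample of size $n$ in $\mathbb R^{p_n}$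 be given, all samples being defined on one probability space (with any dependence between different $n$). Then almost surely, for all sufficiently large $n$ the estimator $\bar\Sigma$ exists and is unique, and $$\Big\|\frac{\psi^{-1}(y)}{n\,y}\,\bar\Sigma-\boldsymbol S_n\Big\|\longrightarrow 0\qquad(n\to\infty).$$ 2. (Rate.) There exist $C,c,c'>0$, depending only on $u$ and $y$, such that for every $0<\varepsilon<c'$ there is $\delta>0$ such that for all $n\ge1$ and all $p$ with $|p/n-y|\le\delta$, $$\Pr\Big(\bar\Sigma\text{ exists, is unique, and }\Big\|\frac{\psi^{-1}(y)}{n\,y}\,\bar\Sigma-\boldsymbol S_n\Big\|\le\varepsilon\Big)\ \ge\ 1-C\,n\,e^{-c\varepsilon^2 n}.$$ In particular this holds for all $n$ if $p/n=y$, and for all sufficiently large $n$ (depending on $\varepsilon$) if $p=p_n$ with $p_n/n\to y$. Note that $\frac{\psi^{-1}(y)}{n\,y}=\frac{1}{n\,u(\psi^{-1}(y))}$. -/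

import Mathlib

open MeasureTheory ProbabilityTheory Filter Set
open scoped Topology Matrix Matrix.Norms.L2Operator

noncomputable section

/-- The function `ψ(x) = x u(x)`. Only its values on `[0, ∞)` matter. -/
def maronnaPsi (u : ℝ → ℝ) (x : ℝ) : ℝ := x * u x

/-- The inverse function `ψ⁻¹` of `ψ : [0, ∞) → [0, ∞)`. -/
def maronnaPsiInv (u : ℝ → ℝ) (t : ℝ) : ℝ := Function.invFunOn (maronnaPsi u) (Ici 0) t

/-- Assumption A1: `u : [0, ∞) → (0, ∞)`, `ψ` is (strictly) increasing, and the limit of `ψ` at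
infinity, which may be `+∞`, is greater than `y`. -/
structure AssumptionA1 (u : ℝ → ℝ) (y : ℝ) : Prop where
  pos : ∀ x, 0 ≤ x → 0 < u x
  psi_strictMonoOn : StrictMonoOn (maronnaPsi u) (Ici 0)
  lim_psi : ∃ L : EReal, Tendsto (fun x : ℝ => (maronnaPsi u x : EReal)) atTop (𝓝 L) ∧
    (y : EReal) < L

/-- Assumption A2: `u` is twice differentiable on `[0, ∞)` (one-sided at `0`), and
`x u'(x) < u(x)`. -/
structure AssumptionA2 (u : ℝ → ℝ) : Prop where
  differentiableOn : DifferentiableOn ℝ u (Ici 0)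
  differentiableOn_deriv : DifferentiableOn ℝ (derivWithin u (Ici 0)) (Ici 0)
  mul_deriv_lt : ∀ x, 0 ≤ x → x * derivWithin u (Ici 0) x < u x

variable {n p : ℕ}

/-- `S` is a solution of Maronna's equation `S = ∑ i, u (xᵢᵀ S⁻¹ xᵢ) xᵢ xᵢᵀ` among the
positive definite matrices. -/
def IsMaronnaSolution (u : ℝ → ℝ) (x : Fin n → EuclideanSpace ℝ (Fin p))
    (S : Matrix (Fin p) (Fin p) ℝ) : Prop :=
  S.PosDef ∧
    S = ∑ i, u ((x i).ofLp ⬝ᵥ (S⁻¹ *ᵥ (x i).ofLp)) • Matrix.vecMulVec (x i).ofLp (x i).ofLp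

open Classical in
/-- Maronna's M-estimator: the solution of Maronna's equation (and `0` if there is none). -/
def maronnaEstimator (u : ℝ → ℝ) (x : Fin n → EuclideanSpace ℝ (Fin p)) :
    Matrix (Fin p) (Fin p) ℝ :=
  if h : ∃ S, IsMaronnaSolution u x S then h.choose else 0

/-- The sample covariance matrix `n⁻¹ ∑ i, xᵢ xᵢᵀ`. -/
def sampleCov (x : Fin n → EuclideanSpace ℝ (Fin p)) : Matrix (Fin p) (Fin p) ℝ :=
  (1 / (n : ℝ)) • ∑ i, Matrix.vecMulVec (x i).ofLp (x i).ofLp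

/-- The operator norm distance between the scaled Maronna estimator
`(ψ⁻¹(y) / (n y)) Σ̄ = Σ̄ / (n u(ψ⁻¹(y)))` and the sample covariance matrix. -/
def maronnaError (u : ℝ → ℝ) (y : ℝ) (x : Fin n → EuclideanSpace ℝ (Fin p)) : ℝ :=
  ‖(maronnaPsiInv u y / ((n : ℝ) * y)) • maronnaEstimator u x - sampleCov x‖

/-- `X 0, …, X (n - 1)` are independent random vectors with law `N(0, I)` on `ℝᵖ`. -/
structure IsGaussianSample {Ω : Type*} [MeasurableSpace Ω] (μ : Measure Ω)
    (X : Fin n → Ω → EuclideanSpace ℝ (Fin p)) : Prop where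
  law : ∀ i, HasLaw (X i) (stdGaussian (EuclideanSpace ℝ (Fin p))) μ
  indep : iIndepFun X μ

end

/-! ### Weighted scatter matrices, Mahalanobis lengths and the hat matrix. -/

section Deterministic

variable {n p : ℕ}

/-! Write `d = ψ⁻¹(y)`, let `d_i` be the quadratic form of the inverse estimator at `x_i`, and let
`H = (h_ij)` be the hat matrix. Maronna's equation is a fixed point equation for `(d_i)`, and the
estimator is the scatter matrix with weights `u(d_i)`. If all ratios `u(d_i)/u(d)` are within `O(ε)`
of 1, the error is at most `O(ε)` times an upper bound for `‖S_n‖`, which is of order one. So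
everything reduces to a uniform estimate of the weights.

In logarithmic coordinates A1 and A2 say that `log u(e^t)` strictly shrinks distances, while the map
from weights to Mahalanobis lengths reverses order and is homogeneous of degree -1, hence
1-Lipschitz in the sup norm. The fixed point map therefore strictly shrinks distances: solutions are
unique, and they exist once a compact box is invariant (`existsUnique_isMaronnaSolution`).

The weights are located from the leverages `h_ii`, which are all close to `p/n`, hence to `y`. If
`ψ'(d) > 0`, the map contracts by a factor `θ < 1` near `log d`, and a box of size `O(ε)` is
invariant (`weightsWithin_of_contraction`). If `ψ'(d)` vanishes there is no such factor, but then
`u'(d) < 0`. Monotonicity of `u` makes a fixed box invariant. The trace identity `∑ w_i d_i = p`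
puts `p/n` between the extreme values of `w_i d_i`, and since each row of `H` is spread over many
indices, the largest and smallest weights differ by a factor `1 + O(ε)` (`weights_ratio_le`,
`weightsWithin_of_spread`).

The probabilistic input comes from the invariance of the Gaussian sample under orthogonal mixing of
the observations (`measurePreserving_mix`). It turns statements about `H` into Chernoff bounds for
Gaussian vectors: `gaussSample_leverage` and `gaussSample_spread`. The norm bound is
`gaussSample_scatter_bound`. A union bound gives the rate, and Borel–Cantelli the almost sure
convergence. -/

/-- The weighted scatter matrix `∑ i, w i • xᵢ xᵢᵀ`. -/
def scatter (x : Fin n → Fin p → ℝ) (w : Fin n → ℝ) : Matrix (Fin p) (Fin p) ℝ :=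
  ∑ i, w i • Matrix.vecMulVec (x i) (x i)

/-- The squared Mahalanobis length of `xᵢ` with respect to the weighted scatter matrix. -/
noncomputable def mahal (x : Fin n → Fin p → ℝ) (w : Fin n → ℝ) (i : Fin n) : ℝ :=
  x i ⬝ᵥ ((scatter x w)⁻¹ *ᵥ x i)

/-- The entries of the hat matrix, the orthogonal projection onto the column space of the data. -/
noncomputable def hat (x : Fin n → Fin p → ℝ) (i j : Fin n) : ℝ :=
  x i ⬝ᵥ ((scatter x 1)⁻¹ *ᵥ x j)

lemma scatter_mulVec (x : Fin n → Fin p → ℝ) (w : Fin n → ℝ) (v : Fin p → ℝ) :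
    scatter x w *ᵥ v = ∑ i, (w i * (x i ⬝ᵥ v)) • x i := by
  simp only [scatter, Matrix.sum_mulVec, Matrix.smul_mulVec, Matrix.vecMulVec_mulVec]
  refine Finset.sum_congr rfl fun i _ => ?_
  ext k
  simp
  ring

lemma dotProduct_scatter_mulVec (x : Fin n → Fin p → ℝ) (w : Fin n → ℝ) (v v' : Fin p → ℝ) :
    v' ⬝ᵥ (scatter x w *ᵥ v) = ∑ i, w i * (x i ⬝ᵥ v) * (x i ⬝ᵥ v') := by
  rw [scatter_mulVec, dotProduct_sum]
  refine Finset.sum_congr rfl fun i _ => ?_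
  rw [dotProduct_smul, smul_eq_mul, dotProduct_comm v']

lemma scatter_quad (x : Fin n → Fin p → ℝ) (w : Fin n → ℝ) (v : Fin p → ℝ) :
    v ⬝ᵥ (scatter x w *ᵥ v) = ∑ i, w i * (x i ⬝ᵥ v) ^ 2 := by
  rw [dotProduct_scatter_mulVec]
  exact Finset.sum_congr rfl fun i _ => by ring

lemma scatter_isHermitian (x : Fin n → Fin p → ℝ) (w : Fin n → ℝ) :
    (scatter x w).IsHermitian := by
  ext k l
  simp only [scatter, Matrix.conjTranspose_apply, Matrix.sum_apply, Matrix.smul_apply,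
    Matrix.vecMulVec_apply, star_trivial, smul_eq_mul]
  exact Finset.sum_congr rfl fun i _ => by ring

lemma posDef_scatter_iff (x : Fin n → Fin p → ℝ) (w : Fin n → ℝ) :
    (scatter x w).PosDef ↔ ∀ v, v ≠ 0 → 0 < ∑ i, w i * (x i ⬝ᵥ v) ^ 2 := by
  constructor
  · intro h v hv
    have := h.dotProduct_mulVec_pos hv
    rwa [star_trivial, scatter_quad] at this
  · intro h
    refine Matrix.PosDef.of_dotProduct_mulVec_pos (scatter_isHermitian x w) fun v hv => ?_
    rw [star_trivial, scatter_quad]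
    exact h v hv

lemma posDef_scatter {x : Fin n → Fin p → ℝ} (hA : (scatter x 1).PosDef) {w : Fin n → ℝ}
    (hw : ∀ i, 0 < w i) : (scatter x w).PosDef := by
  rw [posDef_scatter_iff] at hA ⊢
  intro v hv
  have h1 := hA v hv
  simp only [Pi.one_apply, one_mul] at h1
  obtain ⟨i, -, hi⟩ := Finset.exists_ne_zero_of_sum_ne_zero h1.ne'
  exact Finset.sum_pos' (fun j _ => mul_nonneg (hw j).le (sq_nonneg _))
    ⟨i, Finset.mem_univ _, mul_pos (hw i) (lt_of_le_of_ne (sq_nonneg _) (Ne.symm hi))⟩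

lemma mulVec_inv_mulVec {S : Matrix (Fin p) (Fin p) ℝ} (hS : S.PosDef) (x : Fin p → ℝ) :
    S *ᵥ (S⁻¹ *ᵥ x) = x := by
  rw [Matrix.mulVec_mulVec, Matrix.mul_nonsing_inv _ ((Matrix.isUnit_iff_isUnit_det _).1 hS.isUnit),
    Matrix.one_mulVec]

lemma dotProduct_mulVec_symm {S : Matrix (Fin p) (Fin p) ℝ} (hS : S.IsHermitian)
    (v w : Fin p → ℝ) : v ⬝ᵥ (S *ᵥ w) = w ⬝ᵥ (S *ᵥ v) := by
  rw [Matrix.dotProduct_mulVec, ← Matrix.mulVec_transpose, dotProduct_comm]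
  have : Sᵀ = S := by
    rw [← Matrix.conjTranspose_eq_transpose_of_trivial]; exact hS
  rw [this]

/-- The variational lower bound for the quadratic form of the inverse matrix. -/
lemma two_mul_sub_le_inv_quad {S : Matrix (Fin p) (Fin p) ℝ} (hS : S.PosDef) (x v : Fin p → ℝ) :
    2 * (x ⬝ᵥ v) - v ⬝ᵥ (S *ᵥ v) ≤ x ⬝ᵥ (S⁻¹ *ᵥ x) := by
  set z := S⁻¹ *ᵥ x with hz
  have hSz : S *ᵥ z = x := mulVec_inv_mulVec hS x
  have h := hS.posSemidef.dotProduct_mulVec_nonneg (v - z)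
  rw [star_trivial, Matrix.mulVec_sub, sub_dotProduct, dotProduct_sub, dotProduct_sub, hSz,
    dotProduct_mulVec_symm hS.1 z v, hSz, dotProduct_comm v x, dotProduct_comm z x] at h
  linarith

lemma dotProduct_inv_mulVec {S : Matrix (Fin p) (Fin p) ℝ} (hS : S.PosDef) (x y : Fin p → ℝ) :
    (S⁻¹ *ᵥ x) ⬝ᵥ (S *ᵥ (S⁻¹ *ᵥ y)) = x ⬝ᵥ (S⁻¹ *ᵥ y) := by
  rw [mulVec_inv_mulVec hS, dotProduct_comm, dotProduct_mulVec_symm hS.inv.1]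

lemma hat_comm {x : Fin n → Fin p → ℝ} (hA : (scatter x 1).PosDef) (i j : Fin n) :
    hat x i j = hat x j i :=
  dotProduct_mulVec_symm hA.inv.1 _ _

lemma mahal_one (x : Fin n → Fin p → ℝ) (i : Fin n) : mahal x 1 i = hat x i i := rfl

lemma mahal_eq_sum {x : Fin n → Fin p → ℝ} {w : Fin n → ℝ} (hS : (scatter x w).PosDef)
    (i : Fin n) : mahal x w i = ∑ j, w j * (x j ⬝ᵥ ((scatter x w)⁻¹ *ᵥ x i)) ^ 2 := by
  rw [← scatter_quad, dotProduct_inv_mulVec hS, mahal]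

lemma sum_hat_sq {x : Fin n → Fin p → ℝ} (hA : (scatter x 1).PosDef) (i : Fin n) :
    ∑ j, hat x i j ^ 2 = hat x i i := by
  rw [← mahal_one, mahal_eq_sum hA]
  refine Finset.sum_congr rfl fun j _ => ?_
  rw [hat_comm hA i j, Pi.one_apply, one_mul, hat]

/-- Matrix inversion reverses the Loewner order. The proof inserts the trial vector `c⁻¹ S'⁻¹ x_i`
into the variational bound. -/
lemma mahal_le_mul {x : Fin n → Fin p → ℝ} (hA : (scatter x 1).PosDef) {w w' : Fin n → ℝ}
    (hw : ∀ i, 0 < w i) (hw' : ∀ i, 0 < w' i) {c : ℝ} (hc : 0 < c) (h : ∀ i, w i ≤ c * w' i)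
    (i : Fin n) : mahal x w' i ≤ c * mahal x w i := by
  have hS := posDef_scatter hA hw
  have hS' := posDef_scatter hA hw'
  set z := (scatter x w')⁻¹ *ᵥ x i with hz
  have h1 := two_mul_sub_le_inv_quad hS (x i) (c⁻¹ • z)
  have h2 : z ⬝ᵥ (scatter x w *ᵥ z) ≤ c * mahal x w' i := by
    rw [scatter_quad, mahal_eq_sum hS', Finset.mul_sum]
    refine Finset.sum_le_sum fun j _ => ?_
    rw [← mul_assoc]
    exact mul_le_mul_of_nonneg_right (h j) (sq_nonneg _)
  rw [dotProduct_smul, Matrix.mulVec_smul, smul_dotProduct, dotProduct_smul, smul_eq_mul,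
    smul_eq_mul, smul_eq_mul] at h1
  change _ ≤ mahal x w i at h1
  have h3 : x i ⬝ᵥ z = mahal x w' i := rfl
  rw [h3] at h1
  have h4 : c⁻¹ * (c⁻¹ * z ⬝ᵥ (scatter x w *ᵥ z)) ≤ c⁻¹ * mahal x w' i := by
    refine mul_le_mul_of_nonneg_left ?_ (inv_pos.2 hc).le
    rw [inv_mul_le_iff₀ hc]
    exact h2
  have h5 : c⁻¹ * mahal x w' i ≤ mahal x w i := by linarith
  rwa [inv_mul_le_iff₀ hc] at h5

/-- Because `x_i = ∑ j, h_ij x_j`, the Mahalanobis length equals both `∑ w_j z_j²` and `∑ h_ij z_j`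
with `z_j = x_jᵀ S⁻¹ x_i`. Twice the second minus the first is bounded termwise by completing the
square. -/
lemma mahal_le_sum {x : Fin n → Fin p → ℝ} (hA : (scatter x 1).PosDef) {w : Fin n → ℝ}
    (hw : ∀ i, 0 < w i) (i : Fin n) : mahal x w i ≤ ∑ j, hat x i j ^ 2 / w j := by
  have hS := posDef_scatter hA hw
  set v := (scatter x w)⁻¹ *ᵥ x i with hv
  have h1 : mahal x w i = ∑ j, w j * (x j ⬝ᵥ v) ^ 2 := mahal_eq_sum hS i
  have h2 : mahal x w i = ∑ j, hat x i j * (x j ⬝ᵥ v) := by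
    have h3 : mahal x w i = v ⬝ᵥ (scatter x 1 *ᵥ ((scatter x 1)⁻¹ *ᵥ x i)) := by
      rw [mulVec_inv_mulVec hA, dotProduct_comm]; rfl
    rw [h3, dotProduct_scatter_mulVec]
    refine Finset.sum_congr rfl fun j _ => ?_
    rw [hat_comm hA i j, Pi.one_apply, one_mul, hat]
  have h3 : mahal x w i = ∑ j, (2 * (hat x i j * (x j ⬝ᵥ v)) - w j * (x j ⬝ᵥ v) ^ 2) := by
    rw [Finset.sum_sub_distrib, ← Finset.mul_sum, ← h1, ← h2]; ring
  rw [h3]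
  refine Finset.sum_le_sum fun j _ => ?_
  have hj := hw j
  rw [le_div_iff₀ hj]
  nlinarith [sq_nonneg (hat x i j - w j * (x j ⬝ᵥ v))]

/-- Companion of `mahal_le_sum`: the variational bound at a multiple of the vector that is optimal
for unit weights. The free factor `l` is later the inverse of an upper bound for the weights. -/
lemma le_mahal {x : Fin n → Fin p → ℝ} (hA : (scatter x 1).PosDef) {w : Fin n → ℝ}
    (hw : ∀ i, 0 < w i) (i : Fin n) (l : ℝ) :
    2 * l * hat x i i - l ^ 2 * ∑ j, w j * hat x i j ^ 2 ≤ mahal x w i := by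
  have h1 := two_mul_sub_le_inv_quad (posDef_scatter hA hw) (x i) (l • ((scatter x 1)⁻¹ *ᵥ x i))
  rw [Matrix.mulVec_smul, smul_dotProduct, dotProduct_smul, dotProduct_smul, scatter_quad] at h1
  simp only [smul_eq_mul] at h1
  have h2 : ∑ j, w j * hat x i j ^ 2 = ∑ j, w j * (x j ⬝ᵥ ((scatter x 1)⁻¹ *ᵥ x i)) ^ 2 :=
    Finset.sum_congr rfl fun j _ => by rw [hat_comm hA i j, hat]
  rw [h2]
  refine le_trans (le_of_eq ?_) h1
  rw [hat]
  ring

/-- The trace of `S S⁻¹ = 1`. For a solution it says that the average of `ψ(d_i)` is exactly `p/n`.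
-/
lemma sum_mul_mahal {x : Fin n → Fin p → ℝ} {w : Fin n → ℝ} (hS : (scatter x w).PosDef) :
    ∑ i, w i * mahal x w i = p := by
  have h : (scatter x w * (scatter x w)⁻¹).trace = p := by
    rw [Matrix.mul_nonsing_inv _ ((Matrix.isUnit_iff_isUnit_det _).1 hS.isUnit)]
    simp
  have h' : (∑ i, w i • Matrix.vecMulVec (x i) (x i)) * (scatter x w)⁻¹ =
      scatter x w * (scatter x w)⁻¹ := rfl
  rw [← h, ← h']
  rw [Finset.sum_mul, Matrix.trace_sum]
  refine Finset.sum_congr rfl fun i _ => ?_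
  rw [Matrix.smul_mul, Matrix.trace_smul, Matrix.trace_mul_comm, Matrix.mul_vecMulVec,
    Matrix.trace_vecMulVec, smul_eq_mul, mahal, dotProduct_comm]

/-- A bound for the operator norm of a weighted scatter matrix with signed weights. -/
lemma norm_scatter_le {x : Fin n → Fin p → ℝ} {w : Fin n → ℝ} {a T : ℝ} (ha : 0 ≤ a)
    (hT : 0 ≤ T) (hw : ∀ i, |w i| ≤ a)
    (hx : ∀ v : Fin p → ℝ, ∑ i, (x i ⬝ᵥ v) ^ 2 ≤ T * (v ⬝ᵥ v)) :
    ‖scatter x w‖ ≤ a * T := by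
  rw [← Matrix.l2_opNorm_toEuclideanCLM]
  refine ContinuousLinearMap.opNorm_le_bound _ (by positivity) fun v => ?_
  set z := Matrix.toEuclideanCLM (𝕜 := ℝ) (scatter x w) v with hz
  have hzv : z.ofLp = scatter x w *ᵥ v.ofLp := rfl
  have hn (q : EuclideanSpace ℝ (Fin p)) : q.ofLp ⬝ᵥ q.ofLp = ‖q‖ ^ 2 := by
    rw [EuclideanSpace.real_norm_sq_eq]
    simp [dotProduct, sq]
  -- With `z = S v`, the square `‖z‖²` is the bilinear form at `(v, z)`. Cauchy–Schwarz over the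
  -- observations bounds it by `a T ‖v‖ ‖z‖`, and one factor `‖z‖` cancels.
  have h1 : ‖z‖ ^ 2 = ∑ i, w i * (x i ⬝ᵥ v.ofLp) * (x i ⬝ᵥ z.ofLp) := by
    rw [← dotProduct_scatter_mulVec, ← hzv, hn]
  have h2 : ‖z‖ ^ 2 ≤ a * ∑ i, |x i ⬝ᵥ v.ofLp| * |x i ⬝ᵥ z.ofLp| := by
    rw [h1, Finset.mul_sum]
    refine Finset.sum_le_sum fun i _ => ?_
    refine (le_abs_self _).trans ?_
    rw [abs_mul, abs_mul, mul_assoc]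
    exact mul_le_mul_of_nonneg_right (hw i) (by positivity)
  have h3 : ∑ i, |x i ⬝ᵥ v.ofLp| * |x i ⬝ᵥ z.ofLp| ≤ T * ‖v‖ * ‖z‖ := by
    refine (Real.sum_mul_le_sqrt_mul_sqrt _ _ _).trans ?_
    simp only [sq_abs]
    calc _ ≤ √(T * ‖v‖ ^ 2) * √(T * ‖z‖ ^ 2) := by
          refine mul_le_mul (Real.sqrt_le_sqrt ?_) (Real.sqrt_le_sqrt ?_) (Real.sqrt_nonneg _)
            (Real.sqrt_nonneg _)
          · rw [← hn]; exact hx _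
          · rw [← hn]; exact hx _
      _ = T * ‖v‖ * ‖z‖ := by
          rw [Real.sqrt_mul hT, Real.sqrt_mul hT, Real.sqrt_sq (norm_nonneg _),
            Real.sqrt_sq (norm_nonneg _)]
          have := Real.mul_self_sqrt hT
          linear_combination (‖v‖ * ‖z‖) * this
  rcases (norm_nonneg z).eq_or_lt with h0 | h0
  · rw [← h0]; positivity
  · have h4 : ‖z‖ * ‖z‖ ≤ (a * T * ‖v‖) * ‖z‖ := by
      calc ‖z‖ * ‖z‖ = ‖z‖ ^ 2 := by ring
        _ ≤ a * (T * ‖v‖ * ‖z‖) := h2.trans (mul_le_mul_of_nonneg_left h3 ha)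
        _ = _ := by ring
    exact le_of_mul_le_mul_right h4 h0

end Deterministic

/-! ### The fixed point map in logarithmic coordinates: uniqueness and existence. -/

section Contraction

variable {n p : ℕ}

/-- The weight function in logarithmic coordinates. -/
noncomputable def logWeight (u : ℝ → ℝ) (t : ℝ) : ℝ := Real.log (u (Real.exp t))

/-- The numerator of the derivative of `u(x)/x` is `x u'(x) - u(x)`. -/
lemma AssumptionA2.div_strictAntiOn {u : ℝ → ℝ} (hA2 : AssumptionA2 u) :
    StrictAntiOn (fun x => u x / x) (Ioi 0) := by
  have hd : ∀ x ∈ Ioi (0 : ℝ), HasDerivAt u (derivWithin u (Ici 0) x) x := fun x hx =>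
    (hA2.differentiableOn x (mem_Ici.2 (le_of_lt (mem_Ioi.1 hx)))).hasDerivWithinAt.hasDerivAt
      (Ici_mem_nhds hx)
  have hq : ∀ x ∈ Ioi (0 : ℝ), HasDerivAt (fun x => u x / x)
      ((derivWithin u (Ici 0) x * x - u x * 1) / x ^ 2) x := fun x hx =>
    (hd x hx).div (hasDerivAt_id x) (ne_of_gt hx)
  refine strictAntiOn_of_deriv_neg (convex_Ioi 0)
    (fun x hx => (hq x hx).continuousAt.continuousWithinAt) fun x hx => ?_
  rw [interior_Ioi] at hx
  rw [(hq x hx).deriv]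
  have hx' : (0 : ℝ) < x := hx
  refine div_neg_of_neg_of_pos ?_ (by positivity)
  linarith [hA2.mul_deriv_lt x hx'.le]

/-- Since `log ψ(e^t) = t + log u(e^t)` increases and `log (u(e^t)/e^t) = log u(e^t) - t` decreases,
the increments of `log u(e^t)` are strictly smaller than those of `t` in both directions. -/
lemma abs_logWeight_sub_lt {u : ℝ → ℝ} {y : ℝ} (hA1 : AssumptionA1 u y) (hA2 : AssumptionA2 u)
    {s t : ℝ} (h : s ≠ t) : |logWeight u s - logWeight u t| < |s - t| := by
  wlog hst : s < t generalizing s t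
  · rw [abs_sub_comm, abs_sub_comm s]
    exact this h.symm (lt_of_le_of_ne (not_lt.1 hst) h.symm)
  have hs := Real.exp_pos s
  have ht := Real.exp_pos t
  have hus := hA1.pos _ hs.le
  have hut := hA1.pos _ ht.le
  have he := Real.exp_lt_exp.2 hst
  have h1 := hA1.psi_strictMonoOn (mem_Ici.2 hs.le) (mem_Ici.2 ht.le) he
  have h2 := hA2.div_strictAntiOn (mem_Ioi.2 hs) (mem_Ioi.2 ht) he
  have h3 := Real.log_lt_log (mul_pos hs hus) h1
  have h4 := Real.log_lt_log (div_pos hut ht) h2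
  simp only [maronnaPsi] at h3
  rw [Real.log_mul hs.ne' hus.ne', Real.log_mul ht.ne' hut.ne', Real.log_exp, Real.log_exp] at h3
  rw [Real.log_div hus.ne' hs.ne', Real.log_div hut.ne' ht.ne', Real.log_exp, Real.log_exp] at h4
  rw [abs_lt, abs_of_neg (sub_neg.2 hst)]
  unfold logWeight
  constructor <;> linarith

lemma mahal_pos {x : Fin n → Fin p → ℝ} (hA : (scatter x 1).PosDef) {w : Fin n → ℝ}
    (hw : ∀ i, 0 < w i) {i : Fin n} (hi : 0 < hat x i i) : 0 < mahal x w i := by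
  have hx : x i ≠ 0 := by
    rintro h
    simp [hat, h] at hi
  simpa [mahal] using (posDef_scatter hA hw).inv.dotProduct_mulVec_pos hx

/-- Order reversal together with homogeneity of degree -1 gives the Lipschitz constant 1: weights
that agree up to a factor `e^D` have Mahalanobis lengths that agree up to the same factor. -/
lemma log_mahal_le {x : Fin n → Fin p → ℝ} (hA : (scatter x 1).PosDef) {w w' : Fin n → ℝ}
    (hw : ∀ i, 0 < w i) (hw' : ∀ i, 0 < w' i) {i : Fin n} (hi : 0 < hat x i i) {D : ℝ}
    (h : ∀ j, |Real.log (w j) - Real.log (w' j)| ≤ D) :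
    |Real.log (mahal x w i) - Real.log (mahal x w' i)| ≤ D := by
  have key : ∀ {w w' : Fin n → ℝ}, (∀ i, 0 < w i) → (∀ i, 0 < w' i) →
      (∀ j, |Real.log (w j) - Real.log (w' j)| ≤ D) →
      Real.log (mahal x w' i) ≤ D + Real.log (mahal x w i) := by
    intro w w' hw hw' h
    have h1 : ∀ j, w j ≤ Real.exp D * w' j := fun j => by
      rw [← Real.log_le_log_iff (hw j) (mul_pos (Real.exp_pos _) (hw' j)),
        Real.log_mul (Real.exp_pos _).ne' (hw' j).ne', Real.log_exp]
      linarith [(abs_le.1 (h j)).2]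
    have h2 := mahal_le_mul hA hw hw' (Real.exp_pos D) h1 i
    have h3 := Real.log_le_log (mahal_pos hA hw' hi) h2
    rwa [Real.log_mul (Real.exp_pos _).ne' (mahal_pos hA hw hi).ne', Real.log_exp] at h3
  rw [abs_le]
  constructor
  · linarith [key hw hw' h]
  · linarith [key hw' hw (fun j => by rw [abs_sub_comm]; exact h j)]

/-- The fixed point map of Maronna's equation in logarithmic coordinates. -/
noncomputable def logMaronna (u : ℝ → ℝ) (x : Fin n → Fin p → ℝ) (t : Fin n → ℝ) (i : Fin n) : ℝ :=
  Real.log (mahal x (fun j => u (Real.exp (t j))) i)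

lemma dist_logMaronna_lt {u : ℝ → ℝ} {y : ℝ} (hA1 : AssumptionA1 u y) (hA2 : AssumptionA2 u)
    {x : Fin n → Fin p → ℝ} (hA : (scatter x 1).PosDef) (hpos : ∀ i, 0 < hat x i i)
    {s t : Fin n → ℝ} (hst : s ≠ t) : dist (logMaronna u x s) (logMaronna u x t) < dist s t := by
  have hD : 0 < dist s t := dist_pos.2 hst
  set D' := dist (fun j => logWeight u (s j)) (fun j => logWeight u (t j)) with hD'
  have h1 : D' < dist s t := by
    rw [hD', dist_pi_lt_iff hD]
    intro j
    rcases eq_or_ne (s j) (t j) with h | h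
    · simpa [h] using hD
    · exact (abs_logWeight_sub_lt hA1 hA2 h).trans_le (dist_le_pi_dist s t j)
  have hw : ∀ (r : Fin n → ℝ) j, 0 < u (Real.exp (r j)) := fun r j =>
    hA1.pos _ (Real.exp_pos _).le
  refine lt_of_le_of_lt ((dist_pi_le_iff dist_nonneg).2 fun i => ?_) h1
  exact log_mahal_le hA (hw s) (hw t) (hpos i) fun j =>
    dist_le_pi_dist (fun j => logWeight u (s j)) (fun j => logWeight u (t j)) j

/-- Edelstein's fixed point theorem. -/
lemma exists_fixedPoint_of_dist_lt {α : Type*} [MetricSpace α] {K : Set α} (hK : IsCompact K)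
    (hne : K.Nonempty) {g : α → α} (hg : MapsTo g K K)
    (hlt : ∀ s t, s ≠ t → dist (g s) (g t) < dist s t) : ∃ t ∈ K, g t = t := by
  have hc : Continuous g := by
    refine (LipschitzWith.of_dist_le_mul (K := 1) fun s t => ?_).continuous
    rcases eq_or_ne s t with h | h
    · simp [h]
    · simpa using (hlt s t h).le
  -- At a minimiser of the displacement `dist t (g t)` the displacement must vanish, since applying
  -- `g` would shrink it further.
  obtain ⟨t, ht, hmin⟩ := hK.exists_isMinOn hne (f := fun t => dist t (g t))
    (continuous_id.dist hc).continuousOn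
  refine ⟨t, ht, ?_⟩
  by_contra h
  have h1 := hlt t (g t) (Ne.symm h)
  exact absurd (hmin (hg ht)) (not_le.2 h1)

lemma IsMaronnaSolution.eq_scatter {u : ℝ → ℝ} {X : Fin n → EuclideanSpace ℝ (Fin p)}
    {S : Matrix (Fin p) (Fin p) ℝ} (h : IsMaronnaSolution u X S) :
    S = scatter (fun i => (X i).ofLp) (fun i => u ((X i).ofLp ⬝ᵥ (S⁻¹ *ᵥ (X i).ofLp))) := h.2

lemma IsMaronnaSolution.logMaronna_eq {u : ℝ → ℝ} {X : Fin n → EuclideanSpace ℝ (Fin p)}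
    (hpos : ∀ i, 0 < hat (fun i => (X i).ofLp) i i)
    {S : Matrix (Fin p) (Fin p) ℝ} (h : IsMaronnaSolution u X S) :
    logMaronna u (fun i => (X i).ofLp) (fun i => Real.log ((X i).ofLp ⬝ᵥ (S⁻¹ *ᵥ (X i).ofLp))) =
      fun i => Real.log ((X i).ofLp ⬝ᵥ (S⁻¹ *ᵥ (X i).ofLp)) := by
  have hd : ∀ i, 0 < (X i).ofLp ⬝ᵥ (S⁻¹ *ᵥ (X i).ofLp) := fun i => by
    have hx : (X i).ofLp ≠ 0 := by
      intro h0
      have := hpos i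
      simp [hat, h0] at this
    simpa using h.1.inv.dotProduct_mulVec_pos hx
  funext i
  simp only [logMaronna, mahal, Real.exp_log (hd _), ← h.eq_scatter]

/-- Two different fixed points would contradict strict shrinking, and a solution is recovered from
its quadratic forms through its weights. -/
lemma IsMaronnaSolution.unique {u : ℝ → ℝ} {y : ℝ} (hA1 : AssumptionA1 u y) (hA2 : AssumptionA2 u)
    {X : Fin n → EuclideanSpace ℝ (Fin p)} (hA : (scatter (fun i => (X i).ofLp) 1).PosDef)
    (hpos : ∀ i, 0 < hat (fun i => (X i).ofLp) i i)
    {S S' : Matrix (Fin p) (Fin p) ℝ} (h : IsMaronnaSolution u X S)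
    (h' : IsMaronnaSolution u X S') : S = S' := by
  have key : (fun i => Real.log ((X i).ofLp ⬝ᵥ (S⁻¹ *ᵥ (X i).ofLp))) =
      fun i => Real.log ((X i).ofLp ⬝ᵥ (S'⁻¹ *ᵥ (X i).ofLp)) := by
    by_contra hne
    have := dist_logMaronna_lt hA1 hA2 hA hpos hne
    rw [h.logMaronna_eq hpos, h'.logMaronna_eq hpos] at this
    exact lt_irrefl _ this
  have hd : ∀ {S : Matrix (Fin p) (Fin p) ℝ}, IsMaronnaSolution u X S → ∀ i,
      0 < (X i).ofLp ⬝ᵥ (S⁻¹ *ᵥ (X i).ofLp) := fun h i => by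
    have hx : (X i).ofLp ≠ 0 := by
      intro h0
      have := hpos i
      simp [hat, h0] at this
    simpa using h.1.inv.dotProduct_mulVec_pos hx
  rw [h.eq_scatter, h'.eq_scatter]
  congr 1
  funext i
  rw [Real.log_injOn_pos (hd h i) (hd h' i) (congrFun key i)]

/-- Maronna's equation is uniquely solvable as soon as some box is invariant. -/
lemma existsUnique_isMaronnaSolution {u : ℝ → ℝ} {y : ℝ} (hA1 : AssumptionA1 u y)
    (hA2 : AssumptionA2 u) {X : Fin n → EuclideanSpace ℝ (Fin p)}
    (hA : (scatter (fun i => (X i).ofLp) 1).PosDef)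
    (hpos : ∀ i, 0 < hat (fun i => (X i).ofLp) i i) {m M : ℝ} (hm : 0 < m) (hmM : m ≤ M)
    (hinv : ∀ d : Fin n → ℝ, (∀ i, d i ∈ Icc m M) →
      ∀ i, mahal (fun i => (X i).ofLp) (fun j => u (d j)) i ∈ Icc m M) :
    (∃! S, IsMaronnaSolution u X S) ∧ ∃ d : Fin n → ℝ, (∀ i, d i ∈ Icc m M) ∧
      (∀ i, mahal (fun i => (X i).ofLp) (fun j => u (d j)) i = d i) ∧
      maronnaEstimator u X = scatter (fun i => (X i).ofLp) (fun j => u (d j)) := by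
  set x : Fin n → Fin p → ℝ := fun i => (X i).ofLp with hx
  have hM := hm.trans_le hmM
  have hu : ∀ d : Fin n → ℝ, (∀ i, d i ∈ Icc m M) → ∀ i, 0 < u (d i) := fun d hd i =>
    hA1.pos _ (hm.le.trans (hd i).1)
  obtain ⟨t, htK, ht⟩ := exists_fixedPoint_of_dist_lt
    (K := Set.pi univ fun _ : Fin n => Icc (Real.log m) (Real.log M))
    (isCompact_univ_pi fun _ => isCompact_Icc)
    ⟨fun _ => Real.log m, fun _ _ => ⟨le_rfl, Real.log_le_log hm hmM⟩⟩
    (g := logMaronna u x) (fun t ht i _ => by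
      have h1 := hinv (fun i => Real.exp (t i)) (fun i => by
        have := ht i (mem_univ i)
        exact ⟨(Real.log_le_iff_le_exp hm).1 this.1, (Real.le_log_iff_exp_le hM).1 this.2⟩) i
      exact ⟨Real.log_le_log hm h1.1, Real.log_le_log (hm.trans_le h1.1) h1.2⟩)
    (fun s t hst => dist_logMaronna_lt hA1 hA2 hA hpos hst)
  set d : Fin n → ℝ := fun i => Real.exp (t i) with hd
  have hdK : ∀ i, d i ∈ Icc m M := fun i => by
    have := htK i (mem_univ i)
    exact ⟨(Real.log_le_iff_le_exp hm).1 this.1, (Real.le_log_iff_exp_le hM).1 this.2⟩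
  have hfix : ∀ i, mahal x (fun j => u (d j)) i = d i := fun i => by
    have h1 := congrFun ht i
    rw [logMaronna] at h1
    rw [← Real.exp_log (mahal_pos hA (hu d hdK) (hpos i)), h1]
  have hsol : IsMaronnaSolution u X (scatter x (fun j => u (d j))) := by
    refine ⟨posDef_scatter hA (hu d hdK), ?_⟩
    change _ = scatter x (fun i => u (mahal x (fun j => u (d j)) i))
    simp_rw [hfix]
  have hex : ∃ S, IsMaronnaSolution u X S := ⟨_, hsol⟩
  refine ⟨⟨_, hsol, fun S hS => hS.unique hA1 hA2 hA hpos hsol⟩, d, hdK, hfix, ?_⟩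
  rw [maronnaEstimator, dif_pos hex]
  exact hex.choose_spec.unique hA1 hA2 hA hpos hsol

lemma sampleCov_eq (X : Fin n → EuclideanSpace ℝ (Fin p)) :
    sampleCov X = (1 / (n : ℝ)) • scatter (fun i => (X i).ofLp) 1 := by
  simp [sampleCov, scatter]

lemma scatter_sub (x : Fin n → Fin p → ℝ) (w w' : Fin n → ℝ) :
    scatter x (w - w') = scatter x w - scatter x w' := by
  simp [scatter, sub_smul]

lemma scatter_smul (x : Fin n → Fin p → ℝ) (w : Fin n → ℝ) (a : ℝ) :
    scatter x (a • w) = a • scatter x w := by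
  simp [scatter, Finset.smul_sum, smul_smul]

end Contraction

/-! ### The point `ψ⁻¹(y)` and the reduction of the error to the weights. -/

section PsiInv

variable {u : ℝ → ℝ} {y : ℝ}

lemma maronnaPsiInv_spec (hy : 0 < y) (hA1 : AssumptionA1 u y) (hA2 : AssumptionA2 u) :
    0 < maronnaPsiInv u y ∧ maronnaPsi u (maronnaPsiInv u y) = y := by
  obtain ⟨L, hL, hyL⟩ := hA1.lim_psi
  obtain ⟨b, hb, hb0⟩ := ((hL.eventually_const_lt hyL).and (eventually_ge_atTop 0)).exists
  have hb' : y < maronnaPsi u b := by exact_mod_cast hb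
  have hcont : ContinuousOn (maronnaPsi u) (Icc 0 b) :=
    (continuousOn_id.mul hA2.differentiableOn.continuousOn).mono Icc_subset_Ici_self
  have h0 : maronnaPsi u 0 = 0 := by simp [maronnaPsi]
  obtain ⟨d, hd, hdy⟩ := intermediate_value_Icc hb0 hcont
    (show y ∈ Icc (maronnaPsi u 0) (maronnaPsi u b) from ⟨by rw [h0]; exact hy.le, hb'.le⟩)
  have hex : ∃ a ∈ Ici (0 : ℝ), maronnaPsi u a = y := ⟨d, hd.1, hdy⟩
  have h1 : maronnaPsiInv u y ∈ Ici (0 : ℝ) := Function.invFunOn_mem hex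
  have h2 : maronnaPsi u (maronnaPsiInv u y) = y := Function.invFunOn_eq hex
  refine ⟨lt_of_le_of_ne h1 fun h => ?_, h2⟩
  rw [← h, h0] at h2
  exact hy.ne h2

/-- The scaled difference is `n⁻¹` times the scatter matrix with signed weights `w_i / u(d) - 1`,
because the scaling factor is `1 / (n u(d))`. -/
lemma maronnaError_le {n p : ℕ} (hn : 0 < n) (hy : 0 < y) (hA1 : AssumptionA1 u y)
    (hA2 : AssumptionA2 u)
    {X : Fin n → EuclideanSpace ℝ (Fin p)} {w : Fin n → ℝ}
    (hw : maronnaEstimator u X = scatter (fun i => (X i).ofLp) w) {a T : ℝ} (ha : 0 ≤ a)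
    (hT : 0 ≤ T) (h : ∀ i, |w i / u (maronnaPsiInv u y) - 1| ≤ a)
    (hX : ∀ v : Fin p → ℝ, ∑ i, ((X i).ofLp ⬝ᵥ v) ^ 2 ≤ T * n * (v ⬝ᵥ v)) :
    maronnaError u y X ≤ a * T := by
  obtain ⟨hd, hdy⟩ := maronnaPsiInv_spec hy hA1 hA2
  have hu := hA1.pos _ hd.le
  have hn' : (0 : ℝ) < n := by exact_mod_cast hn
  set d := maronnaPsiInv u y
  have hc : d / (n * y) = (1 / n) * (u d)⁻¹ := by
    rw [← hdy, maronnaPsi]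
    field_simp
  rw [maronnaError, hw, sampleCov_eq, hc, mul_smul, ← smul_sub, ← scatter_smul, ← scatter_sub,
    norm_smul, Real.norm_of_nonneg (by positivity)]
  have h1 := norm_scatter_le (x := fun i => (X i).ofLp) (w := (u d)⁻¹ • w - 1) ha
    (by positivity : 0 ≤ T * n) (fun i => by
      have := h i
      rwa [div_eq_inv_mul] at this) hX
  calc 1 / (n : ℝ) * _ ≤ 1 / n * (a * (T * n)) := mul_le_mul_of_nonneg_left h1 (by positivity)
    _ = a * T := by field_simp

end PsiInv

/-! ### Locating the weights when `ψ'(d) > 0`. -/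

section Location

variable {n p : ℕ} {u : ℝ → ℝ} {y : ℝ}

/-- The conclusion of the location estimates: Maronna's estimator exists, is unique, and its
weights are uniformly within relative distance `a` of `u (ψ⁻¹ y)`. -/
def WeightsWithin (u : ℝ → ℝ) (y a : ℝ) (X : Fin n → EuclideanSpace ℝ (Fin p)) : Prop :=
  (∃! S, IsMaronnaSolution u X S) ∧ ∃ w : Fin n → ℝ,
    maronnaEstimator u X = scatter (fun i => (X i).ofLp) w ∧
    ∀ i, |w i / u (maronnaPsiInv u y) - 1| ≤ a

lemma abs_log_le_two_mul {z : ℝ} (hz : |z - 1| ≤ 1 / 2) : |Real.log z| ≤ 2 * |z - 1| := by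
  have hz' := abs_le.1 hz
  have hpos : 0 < z := by linarith
  have h1 := Real.log_le_sub_one_of_pos hpos
  have h2 := Real.log_le_sub_one_of_pos (inv_pos.2 hpos)
  rw [Real.log_inv] at h2
  have h3 : z⁻¹ - 1 ≤ 2 * |z - 1| := by
    rw [sub_le_iff_le_add, inv_le_iff_one_le_mul₀ hpos]
    rcases abs_cases (z - 1) with ⟨h, h'⟩ | ⟨h, h'⟩ <;> rw [h] <;> nlinarith
  rw [abs_le]
  constructor
  · linarith
  · linarith [le_abs_self (z - 1), abs_nonneg (z - 1)]

lemma hasDerivAt_u (hA2 : AssumptionA2 u) {d : ℝ} (hd : 0 < d) :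
    HasDerivAt u (derivWithin u (Ici 0) d) d :=
  (hA2.differentiableOn d (mem_Ici.2 hd.le)).hasDerivWithinAt.hasDerivAt (Ici_mem_nhds hd)

/-- If `ψ' (d) > 0`, the fixed point map is locally a contraction. -/
lemma exists_contraction (hA1 : AssumptionA1 u y) (hA2 : AssumptionA2 u) {d : ℝ} (hd : 0 < d)
    (hψ : 0 < u d + d * derivWithin u (Ici 0) d) :
    ∃ r0 > 0, ∃ θ, 0 ≤ θ ∧ θ < 1 ∧ ∀ t, |t - Real.log d| ≤ r0 →
      |logWeight u t - logWeight u (Real.log d)| ≤ θ * |t - Real.log d| := by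
  have hud := hA1.pos d hd.le
  set u' := derivWithin u (Ici 0) d with hu'
  have hder : HasDerivAt (logWeight u) (u' * d / u d) (Real.log d) := by
    have h1 : HasDerivAt (fun t => u (Real.exp t)) (u' * d) (Real.log d) := by
      have h2 := hasDerivAt_u hA2 hd
      have h3 := Real.hasDerivAt_exp (Real.log d)
      have h4 := Real.exp_log hd
      rw [h4] at h3
      rw [← h4] at h2
      have := h2.comp (Real.log d) h3
      rwa [h4] at this
    have h5 := h1.log (by rw [Real.exp_log hd]; exact hud.ne')
    rwa [Real.exp_log hd] at h5
  -- The logarithmic derivative of `u` at `d` exceeds -1 because `ψ'(d) > 0`, and is below 1 by A2.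
  -- Any `θ` strictly in between leaves room for the error of the linear approximation.
  have hlt : |u' * d / u d| < 1 := by
    rw [abs_lt, lt_div_iff₀ hud, div_lt_iff₀ hud]
    constructor
    · linarith
    · linarith [hA2.mul_deriv_lt d hd.le]
  obtain ⟨θ, hθ, hθ1⟩ := exists_between hlt
  have h6 := (hasDerivAt_iff_isLittleO.1 hder).def (sub_pos.2 hθ)
  obtain ⟨r, hr, hball⟩ := Metric.eventually_nhds_iff.1 h6
  refine ⟨r / 2, by positivity, θ, (abs_nonneg _).trans hθ.le, hθ1, fun t ht => ?_⟩
  have h7 := hball (y := t) (by rw [Real.dist_eq]; linarith)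
  simp only [Real.norm_eq_abs, smul_eq_mul] at h7
  have h8 : |logWeight u t - logWeight u (Real.log d)| ≤
      |logWeight u t - logWeight u (Real.log d) - (t - Real.log d) * (u' * d / u d)| +
      |(t - Real.log d) * (u' * d / u d)| := by
    have := abs_add_le (logWeight u t - logWeight u (Real.log d) -
      (t - Real.log d) * (u' * d / u d)) ((t - Real.log d) * (u' * d / u d))
    rwa [sub_add_cancel] at this
  rw [abs_mul] at h8
  linarith

lemma mahal_le_div {x : Fin n → Fin p → ℝ} (hA : (scatter x 1).PosDef) {w : Fin n → ℝ}
    (hw : ∀ i, 0 < w i) {a : ℝ} (ha : 0 < a) (h : ∀ i, a ≤ w i) (i : Fin n) :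
    mahal x w i ≤ hat x i i / a := by
  have h1 := mahal_le_mul hA (w := 1) (fun _ => one_pos) hw (inv_pos.2 ha) (fun j => by
    rw [Pi.one_apply, ← inv_mul_cancel₀ ha.ne']
    exact mul_le_mul_of_nonneg_left (h j) (inv_pos.2 ha).le) i
  rwa [mahal_one, ← div_eq_inv_mul] at h1

lemma div_le_mahal {x : Fin n → Fin p → ℝ} (hA : (scatter x 1).PosDef) {w : Fin n → ℝ}
    (hw : ∀ i, 0 < w i) {a : ℝ} (ha : 0 < a) (h : ∀ i, w i ≤ a) (i : Fin n) :
    hat x i i / a ≤ mahal x w i := by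
  have h1 := mahal_le_mul hA (w' := 1) hw (fun _ => one_pos) ha (fun j => by
    rw [Pi.one_apply, mul_one]; exact h j) i
  rw [mahal_one] at h1
  rwa [div_le_iff₀' ha]

/-- With constant weights `u(d)` the Mahalanobis lengths are `h_ii / u(d)`, within `(1 - θ) r` of `d
= y / u(d)` on the log scale. Varying the weights over the log box of radius `r` adds at most `θ r`,
so the box is invariant. -/
lemma weightsWithin_of_contraction (hy : 0 < y) (hA1 : AssumptionA1 u y) (hA2 : AssumptionA2 u)
    (hψ : 0 < u (maronnaPsiInv u y) +
      maronnaPsiInv u y * derivWithin u (Ici 0) (maronnaPsiInv u y)) :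
    ∃ K c' : ℝ, 0 < K ∧ 0 < c' ∧ ∀ ε, 0 < ε → ε < c' → ∃ δ, 0 < δ ∧ ∀ n p : ℕ,
      |(p : ℝ) / n - y| ≤ δ → ∀ X : Fin n → EuclideanSpace ℝ (Fin p),
      (scatter (fun i => (X i).ofLp) 1).PosDef →
      (∀ i, |hat (fun i => (X i).ofLp) i i - (p : ℝ) / n| ≤ ε) →
      WeightsWithin u y (K * ε) X := by
  obtain ⟨hd, hdy⟩ := maronnaPsiInv_spec hy hA1 hA2
  unfold WeightsWithin
  set d := maronnaPsiInv u y
  have hud := hA1.pos d hd.le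
  obtain ⟨r0, hr0, θ, hθ0, hθ1, hθ⟩ := exists_contraction hA1 hA2 hd hψ
  have hθ' : 0 < 1 - θ := sub_pos.2 hθ1
  -- With `δ = ε` the leverages are within `2ε` of `y`, so their logarithms are within `4ε/y = (1 -
  -- θ) K ε`. The bounds on `ε` validate the logarithm estimate, keep the box in the contraction
  -- region and allow `|e^t - 1| ≤ 2|t|`, whence the factor 2 in `2 * K`.
  set K := 4 / (y * (1 - θ)) with hK
  have hKpos : 0 < K := by positivity
  refine ⟨2 * K, min (y / 4) (min (r0 / K) (1 / K)), by positivity, by positivity,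
    fun ε hε hεc => ⟨ε, hε, fun n p hpn X hA hh => ?_⟩⟩
  have hε1 : ε < y / 4 := hεc.trans_le (min_le_left _ _)
  have hε2 : K * ε < r0 := by
    have := hεc.trans_le ((min_le_right _ _).trans (min_le_left _ _))
    rwa [lt_div_iff₀' hKpos] at this
  have hε3 : K * ε < 1 := by
    have := hεc.trans_le ((min_le_right _ _).trans (min_le_right _ _))
    rwa [lt_div_iff₀' hKpos] at this
  set x : Fin n → Fin p → ℝ := fun i => (X i).ofLp
  set r := K * ε with hr
  have hrpos : 0 < r := by positivity
  have hlog : ∀ i, 0 < hat x i i ∧ |Real.log (hat x i i) - Real.log y| ≤ (1 - θ) * r := by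
    intro i
    have h1 : |hat x i i - y| ≤ 2 * ε := by
      have := abs_add_le (hat x i i - (p : ℝ) / n) ((p : ℝ) / n - y)
      rw [sub_add_sub_cancel] at this
      linarith [hh i]
    have h2 := abs_le.1 h1
    have hpos : 0 < hat x i i := by linarith
    refine ⟨hpos, ?_⟩
    have h3 : |hat x i i / y - 1| ≤ 2 * ε / y := by
      rw [div_sub_one hy.ne', abs_div, abs_of_pos hy]
      exact div_le_div_of_nonneg_right h1 hy.le
    have h4 : 2 * ε / y ≤ 1 / 2 := by rw [div_le_iff₀ hy]; linarith
    rw [← Real.log_div hpos.ne' hy.ne']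
    refine (abs_log_le_two_mul (h3.trans h4)).trans ?_
    have h5 : (1 - θ) * r = 2 * (2 * ε / y) := by
      rw [hr, hK]; field_simp; norm_num
    rw [h5]
    linarith
  have hbox : ∀ a : ℝ, a ∈ Icc (d * Real.exp (-r)) (d * Real.exp r) ↔
      0 < a ∧ |Real.log a - Real.log d| ≤ r := by
    intro a
    have he : ∀ b, d * Real.exp b = Real.exp (Real.log d + b) := fun b => by
      rw [Real.exp_add, Real.exp_log hd]
    rw [he, he, mem_Icc, abs_le]
    constructor
    · rintro ⟨h1, h2⟩
      have ha : 0 < a := (Real.exp_pos _).trans_le h1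
      refine ⟨ha, ?_, ?_⟩
      · linarith [(Real.le_log_iff_exp_le ha).2 h1]
      · linarith [(Real.log_le_iff_le_exp ha).2 h2]
    · rintro ⟨ha, h1, h2⟩
      exact ⟨(Real.le_log_iff_exp_le ha).1 (by linarith),
        (Real.log_le_iff_le_exp ha).1 (by linarith)⟩
  have hwt : ∀ a : ℝ, 0 < a → |Real.log a - Real.log d| ≤ r →
      |Real.log (u a) - Real.log (u d)| ≤ θ * r := by
    intro a ha h
    have := hθ (Real.log a) (h.trans hε2.le)
    simp only [logWeight, Real.exp_log ha, Real.exp_log hd] at this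
    exact this.trans (mul_le_mul_of_nonneg_left h hθ0)
  have hlogd : Real.log d = Real.log y - Real.log (u d) := by
    rw [← hdy, maronnaPsi, Real.log_mul hd.ne' hud.ne']; ring
  obtain ⟨huniq, e, heK, -, hest⟩ := existsUnique_isMaronnaSolution hA1 hA2 hA
    (fun i => (hlog i).1) (m := d * Real.exp (-r)) (M := d * Real.exp r) (by positivity)
    (by gcongr; linarith) (fun e he i => by
      have he' := fun i => (hbox _).1 (he i)
      have hw : ∀ j, 0 < u (e j) := fun j => hA1.pos _ (he' j).1.le
      have hpos := mahal_pos hA hw (hlog i).1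
      refine (hbox _).2 ⟨hpos, ?_⟩
      have h1 := log_mahal_le hA hw (w' := fun _ => u d) (fun _ => hud) (hlog i).1
        (fun j => hwt _ (he' j).1 (he' j).2)
      have h2 : mahal x (fun _ => u d) i = hat x i i / u d :=
        le_antisymm (mahal_le_div hA (fun _ => hud) hud (fun _ => le_rfl) i)
          (div_le_mahal hA (fun _ => hud) hud (fun _ => le_rfl) i)
      rw [h2, Real.log_div (hlog i).1.ne' hud.ne'] at h1
      have h3 := (hlog i).2
      rw [hlogd]
      have := abs_add_le (Real.log (mahal x (fun j => u (e j)) i) -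
        (Real.log (hat x i i) - Real.log (u d))) (Real.log (hat x i i) - Real.log y)
      calc _ = |Real.log (mahal x (fun j => u (e j)) i) -
        (Real.log (hat x i i) - Real.log (u d)) + (Real.log (hat x i i) - Real.log y)| := by
            congr 1; ring
        _ ≤ θ * r + (1 - θ) * r := by linarith
        _ = r := by ring)
  refine ⟨huniq, _, hest, fun i => ?_⟩
  have he' := (hbox _).1 (heK i)
  have h1 := hwt _ he'.1 he'.2
  have hui := hA1.pos _ he'.1.le
  have h2 : θ * r ≤ r := by nlinarith
  rw [← Real.log_div hui.ne' hud.ne'] at h1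
  rw [← Real.exp_log (div_pos hui hud)]
  refine (Real.abs_exp_sub_one_le (by linarith)).trans ?_
  rw [mul_assoc]
  linarith

end Location

/-! ### Locating the weights when `ψ'(d)` vanishes. -/

section Spread

variable {n p : ℕ} {u : ℝ → ℝ} {y : ℝ}

/-- Second differentiability enters here: it makes `u'` continuous, so its negative sign persists
near `d`. -/
lemma exists_antitoneOn (hA2 : AssumptionA2 u) {d : ℝ} (hd : 0 < d)
    (hu' : derivWithin u (Ici 0) d < 0) :
    ∃ r, 0 < r ∧ r < d ∧ AntitoneOn u (Icc (d - r) (d + r)) := by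
  have hcont : ContinuousAt (derivWithin u (Ici 0)) d :=
    (hA2.differentiableOn_deriv d (mem_Ici.2 hd.le)).continuousWithinAt.continuousAt
      (Ici_mem_nhds hd)
  obtain ⟨r, hr, hball⟩ := Metric.eventually_nhds_iff.1 (hcont.eventually_lt_const hu')
  set s := min (r / 2) (d / 2)
  have hs : 0 < s := by positivity
  have hsr : s ≤ r / 2 := min_le_left _ _
  have hsd : s ≤ d / 2 := min_le_right _ _
  refine ⟨s, hs, by linarith, antitoneOn_of_deriv_nonpos (convex_Icc _ _) ?_ ?_ ?_⟩
  · exact hA2.differentiableOn.continuousOn.mono fun a ha => mem_Ici.2 (by linarith [ha.1])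
  · intro a ha
    rw [interior_Icc] at ha
    exact (hasDerivAt_u hA2 (by linarith [ha.1])).differentiableAt.differentiableWithinAt
  · intro a ha
    rw [interior_Icc] at ha
    rw [(hasDerivAt_u hA2 (by linarith [ha.1])).deriv]
    refine (hball ?_).le
    rw [Real.dist_eq, abs_lt]
    constructor <;> linarith [ha.1, ha.2]

/-- Every row of the hat matrix puts mass at least `α` on every set of at least `n / 4` other
indices. -/
def HatSpread (x : Fin n → Fin p → ℝ) (α : ℝ) : Prop :=
  ∀ i, ∀ J : Finset (Fin n), i ∉ J → n ≤ 4 * J.card → α ≤ ∑ j ∈ J, hat x i j ^ 2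

/-- Dropping `i` from at least `n / 2` indices leaves at least `n / 4` as soon as `n ≥ 4`. -/
lemma HatSpread.le_sum {x : Fin n → Fin p → ℝ} {α : ℝ} (h : HatSpread x α) (hn : 4 ≤ n) (i : Fin n)
    (J : Finset (Fin n)) (hJ : n ≤ 2 * J.card) : α ≤ ∑ j ∈ J, hat x i j ^ 2 := by
  refine (h i (J.erase i) (Finset.notMem_erase i J) ?_).trans
    (Finset.sum_le_sum_of_subset_of_nonneg (Finset.erase_subset i J) fun _ _ _ => sq_nonneg _)
  have := Finset.pred_card_le_card_erase (s := J) (a := i)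
  omega

/-- Weights at least `a` give the bound `h_ii / a`. The indices in `J`, whose weights are at least
`b`, improve it in proportion to the mass `∑ h_ij²` that they carry, the total mass being `h_ii`. -/
lemma mahal_le_of_spread {x : Fin n → Fin p → ℝ} (hA : (scatter x 1).PosDef) {w : Fin n → ℝ}
    {a b α : ℝ} (ha : 0 < a) (hab : a ≤ b) (hw : ∀ i, a ≤ w i) (i : Fin n) (J : Finset (Fin n))
    (hJ : ∀ j ∈ J, b ≤ w j) (hα : α ≤ ∑ j ∈ J, hat x i j ^ 2) :
    a * mahal x w i ≤ hat x i i - α * (1 - a / b) := by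
  have hb := ha.trans_le hab
  have h1 := mahal_le_sum hA (fun i => ha.trans_le (hw i)) i
  have h2 : ∑ j, hat x i j ^ 2 / w j ≤ ∑ j, (hat x i j ^ 2 / a -
      if j ∈ J then hat x i j ^ 2 * (1 / a - 1 / b) else 0) := by
    refine Finset.sum_le_sum fun j _ => ?_
    split_ifs with h
    · rw [mul_sub, mul_one_div, mul_one_div, sub_sub_cancel]
      exact div_le_div_of_nonneg_left (sq_nonneg _) hb (hJ j h)
    · rw [sub_zero]
      exact div_le_div_of_nonneg_left (sq_nonneg _) ha (hw j)
  rw [Finset.sum_sub_distrib, ← Finset.sum_div, sum_hat_sq hA, Finset.sum_ite_mem,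
    Finset.univ_inter, ← Finset.sum_mul] at h2
  have h3 : α * (1 / a - 1 / b) ≤ (∑ j ∈ J, hat x i j ^ 2) * (1 / a - 1 / b) :=
    mul_le_mul_of_nonneg_right hα (sub_nonneg.2 (one_div_le_one_div_of_le ha hab))
  have h4 : mahal x w i ≤ hat x i i / a - α * (1 / a - 1 / b) := by linarith
  calc a * mahal x w i ≤ a * (hat x i i / a - α * (1 / a - 1 / b)) :=
        mul_le_mul_of_nonneg_left h4 ha.le
    _ = hat x i i - α * (1 - a / b) := by field_simp

lemma le_mahal_of_spread {x : Fin n → Fin p → ℝ} (hA : (scatter x 1).PosDef) {w : Fin n → ℝ}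
    {a b α : ℝ} (ha : 0 < a) (hba : b ≤ a) (hw0 : ∀ i, 0 < w i) (hw : ∀ i, w i ≤ a) (i : Fin n)
    (J : Finset (Fin n)) (hJ : ∀ j ∈ J, w j ≤ b) (hα : α ≤ ∑ j ∈ J, hat x i j ^ 2) :
    hat x i i + α * (1 - b / a) ≤ a * mahal x w i := by
  have h1 := le_mahal hA hw0 i a⁻¹
  have h2 : ∑ j, w j * hat x i j ^ 2 ≤ ∑ j, (a * hat x i j ^ 2 -
      if j ∈ J then hat x i j ^ 2 * (a - b) else 0) := by
    refine Finset.sum_le_sum fun j _ => ?_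
    split_ifs with h
    · nlinarith [hJ j h, sq_nonneg (hat x i j)]
    · rw [sub_zero]
      exact mul_le_mul_of_nonneg_right (hw j) (sq_nonneg _)
  rw [Finset.sum_sub_distrib, ← Finset.mul_sum, sum_hat_sq hA, Finset.sum_ite_mem,
    Finset.univ_inter, ← Finset.sum_mul] at h2
  have h3 : α * (a - b) ≤ (∑ j ∈ J, hat x i j ^ 2) * (a - b) :=
    mul_le_mul_of_nonneg_right hα (sub_nonneg.2 hba)
  have h4 : (a⁻¹) ^ 2 * ∑ j, w j * hat x i j ^ 2 ≤ (a⁻¹) ^ 2 * (a * hat x i i - α * (a - b)) :=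
    mul_le_mul_of_nonneg_left (by linarith) (by positivity)
  calc hat x i i + α * (1 - b / a)
      = a * (2 * a⁻¹ * hat x i i - (a⁻¹) ^ 2 * (a * hat x i i - α * (a - b))) := by
        field_simp; ring
    _ ≤ a * mahal x w i := mul_le_mul_of_nonneg_left (by linarith) ha.le

/-- The spread of the weights of a solution is controlled by the fluctuations of the leverages. -/
lemma weights_ratio_le {x : Fin n → Fin p → ℝ} (hA : (scatter x 1).PosDef) {α ε q : ℝ}
    (hα : 0 < α) (hε : 0 < ε) (hεα : 4 * ε ≤ α) (hn : 4 ≤ n) (hspread : HatSpread x α)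
    (hh : ∀ i, |hat x i i - q| ≤ ε) {w : Fin n → ℝ} (hw : ∀ i, 0 < w i) {k l : Fin n}
    (hk : ∀ i, w k ≤ w i) (hl : ∀ i, w i ≤ w l) (hqk : q ≤ w k * mahal x w k)
    (hql : w l * mahal x w l ≤ q) : w l ≤ (1 + 4 * (ε / α)) * w k := by
  set ρ := ε / α with hρ
  have hρ0 : 0 < ρ := by positivity
  have hρ4 : ρ ≤ 1 / 4 := by rw [hρ, div_le_iff₀ hα]; linarith
  have hερ : ε = ρ * α := by rw [hρ]; field_simp
  set mid := (w k + w l) / 2 with hmid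
  have hwk := hw k
  have hwl := hw l
  have hkl := hk l
  have hkm : w k ≤ mid := by linarith
  have hml : mid ≤ w l := by linarith
  -- Half of the weights lie on one side of the midpoint of the extremes. Most above makes the
  -- length at the smallest weight too small unless `w k` is near `mid`; most below makes the length
  -- at the largest weight too large unless `w l` is near `mid`.
  have hcard : n ≤ 2 * (Finset.univ.filter fun i => mid ≤ w i).card ∨
      n ≤ 2 * (Finset.univ.filter fun i => w i ≤ mid).card := by
    have h1 : (Finset.univ : Finset (Fin n)) ⊆
        (Finset.univ.filter fun i => mid ≤ w i) ∪ (Finset.univ.filter fun i => w i ≤ mid) := by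
      intro i _
      simp [le_total]
    have h2 := (Finset.card_le_card h1).trans (Finset.card_union_le _ _)
    rw [Finset.card_univ, Fintype.card_fin] at h2
    omega
  rcases hcard with hJ | hJ
  · have h1 := mahal_le_of_spread hA hwk hkm hk k _ (fun j hj => (Finset.mem_filter.1 hj).2)
      (hspread.le_sum hn k _ hJ)
    have h2 : α * (1 - w k / mid) ≤ α * ρ := by linarith [(abs_le.1 (hh k)).2]
    have h3 : 1 - w k / mid ≤ ρ := le_of_mul_le_mul_left h2 hα
    have h4 : 1 - ρ ≤ w k / mid := by linarith
    rw [le_div_iff₀ (hwk.trans_le hkm)] at h4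
    nlinarith [mul_pos hρ0 hwk]
  · have h1 := le_mahal_of_spread hA hwl hml hw hl l _ (fun j hj => (Finset.mem_filter.1 hj).2)
      (hspread.le_sum hn l _ hJ)
    have h2 : α * (1 - mid / w l) ≤ α * ρ := by linarith [(abs_le.1 (hh l)).1]
    have h3 : 1 - mid / w l ≤ ρ := le_of_mul_le_mul_left h2 hα
    have h4 : 1 - ρ ≤ mid / w l := by linarith
    rw [le_div_iff₀ hwl] at h4
    -- Here `(1 - 2ρ) w_l ≤ w_k`, and `1 / (1 - 2ρ) ≤ 1 + 4ρ` exactly when `ρ ≤ 1/4`; this is the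
    -- origin of `4 * ε ≤ α`.
    nlinarith [mul_pos hρ0 hwk]

lemma abs_div_sub_one_le {a c ε ρ : ℝ} (hc : 0 < c) (hε : 0 ≤ ε) (hε1 : ε ≤ 1) (hρ : 0 ≤ ρ)
    (hup : a ≤ (1 + 4 * ρ) * ((1 + ε) * c)) (hlo : (1 - ε) * c ≤ (1 + 4 * ρ) * a) :
    |a / c - 1| ≤ ε + 8 * ρ := by
  obtain ⟨b, rfl⟩ : ∃ b, a = b * c := ⟨a / c, by field_simp⟩
  rw [mul_div_cancel_right₀ _ hc.ne']
  have hup' : b ≤ (1 + 4 * ρ) * (1 + ε) :=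
    le_of_mul_le_mul_right (by linarith) hc
  have hlo' : 1 - ε ≤ (1 + 4 * ρ) * b :=
    le_of_mul_le_mul_right (by linarith) hc
  have h1 : ρ * ε ≤ ρ := mul_le_of_le_one_right hρ hε1
  have h2 : 0 ≤ ρ * ε := mul_nonneg hρ hε
  rw [abs_le]
  constructor
  · by_contra hcon
    have h3 : b ≤ 1 - ε - 8 * ρ := by linarith
    have h4 : (1 + 4 * ρ) * b ≤ (1 + 4 * ρ) * (1 - ε - 8 * ρ) :=
      mul_le_mul_of_nonneg_left h3 (by positivity)
    have h5 : 0 ≤ ρ * ρ := mul_nonneg hρ hρ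
    have h6 : 0 < ρ := by
      rcases hρ.eq_or_lt with h | h
      · rw [← h] at hlo' hcon
        exact absurd (by linarith) hcon
      · exact h
    linarith
  · linarith

/-- Since `u` decreases near `d`, weights on `[d - r, d + r]` lie between `u(d + r)` and `u(d - r)`,
and the box is invariant once every leverage lies between `ψ(d - r)` and `ψ(d + r)`. The box has
fixed size; the rate comes from the ratio of the extreme weights, which enclose a value close to
`u(d)`. -/
lemma weightsWithin_of_spread (hy : 0 < y) (hA1 : AssumptionA1 u y) (hA2 : AssumptionA2 u)
    (hu' : derivWithin u (Ici 0) (maronnaPsiInv u y) < 0) {α : ℝ} (hα : 0 < α) :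
    ∃ K c' : ℝ, 0 < K ∧ 0 < c' ∧ ∀ ε, 0 < ε → ε < c' → ∃ δ, 0 < δ ∧ ∀ n p : ℕ, 4 ≤ n →
      |(p : ℝ) / n - y| ≤ δ → ∀ X : Fin n → EuclideanSpace ℝ (Fin p),
      (scatter (fun i => (X i).ofLp) 1).PosDef →
      (∀ i, |hat (fun i => (X i).ofLp) i i - (p : ℝ) / n| ≤ ε) →
      HatSpread (fun i => (X i).ofLp) α →
      WeightsWithin u y (K * ε) X := by
  obtain ⟨hd, hdy⟩ := maronnaPsiInv_spec hy hA1 hA2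
  unfold WeightsWithin
  set d := maronnaPsiInv u y
  have hud := hA1.pos d hd.le
  obtain ⟨r, hr, hrd, hanti⟩ := exists_antitoneOn hA2 hd hu'
  have hψ : ∀ {a b : ℝ}, 0 ≤ a → 0 ≤ b → (maronnaPsi u a ≤ maronnaPsi u b ↔ a ≤ b) :=
    fun ha hb => hA1.psi_strictMonoOn.le_iff_le (mem_Ici.2 ha) (mem_Ici.2 hb)
  have hψ' : ∀ {a b : ℝ}, 0 ≤ a → 0 ≤ b → a < b → maronnaPsi u a < maronnaPsi u b :=
    fun ha hb h => hA1.psi_strictMonoOn (mem_Ici.2 ha) (mem_Ici.2 hb) h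
  have hm : 0 < d - r := by linarith
  have hψm : maronnaPsi u (d - r) < y := by
    have := hψ' hm.le hd.le (by linarith); rwa [hdy] at this
  have hψM : y < maronnaPsi u (d + r) := by
    have := hψ' hd.le (by linarith : 0 ≤ d + r) (by linarith); rwa [hdy] at this
  refine ⟨1 + 8 / α, min (min (α / 4) (min 1 (y / 4)))
    (min ((y - maronnaPsi u (d - r)) / 2) ((maronnaPsi u (d + r) - y) / 2)), by positivity,
    lt_min (by positivity) (lt_min (by linarith) (by linarith)), fun ε hε hεc => ?_⟩
  have hε1 : ε < α / 4 := hεc.trans_le ((min_le_left _ _).trans (min_le_left _ _))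
  have hε2 : ε < 1 :=
    hεc.trans_le ((min_le_left _ _).trans ((min_le_right _ _).trans (min_le_left _ _)))
  have hε5 : ε < y / 4 :=
    hεc.trans_le ((min_le_left _ _).trans ((min_le_right _ _).trans (min_le_right _ _)))
  have hε3 : ε < (y - maronnaPsi u (d - r)) / 2 :=
    hεc.trans_le ((min_le_right _ _).trans (min_le_left _ _))
  have hε4 : ε < (maronnaPsi u (d + r) - y) / 2 :=
    hεc.trans_le ((min_le_right _ _).trans (min_le_right _ _))
  have hcont : ContinuousAt u d := (hasDerivAt_u hA2 hd).continuousAt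
  obtain ⟨η', hη', hball⟩ := Metric.continuousAt_iff.1 hcont (ε * u d) (by positivity)
  -- `u` varies by at most `ε u(d)` on `[d - η, d + η]`, and `δ` is chosen so that `p/n` stays
  -- between `ψ(d - η)` and `ψ(d + η)`. As `ψ` may be flat at `d`, `δ` need not be proportional to
  -- `ε`.
  set η := min (η' / 2) r
  have hη : 0 < η := by positivity
  have hηr : η ≤ r := min_le_right _ _
  have hηη : η ≤ η' / 2 := min_le_left _ _
  have hψη : maronnaPsi u (d - η) < y := by
    have := hψ' (by linarith : 0 ≤ d - η) hd.le (by linarith); rwa [hdy] at this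
  have hψη' : y < maronnaPsi u (d + η) := by
    have := hψ' hd.le (by linarith : 0 ≤ d + η) (by linarith); rwa [hdy] at this
  refine ⟨min ε (min (y - maronnaPsi u (d - η)) (maronnaPsi u (d + η) - y)),
    lt_min hε (lt_min (by linarith) (by linarith)), fun n p hn hpn X hA hh hspread => ?_⟩
  have hp0 := abs_le.1 (hpn.trans (min_le_left _ _))
  have hp1 := (abs_le.1 (hpn.trans ((min_le_right _ _).trans (min_le_left _ _)))).1
  have hp2 := (abs_le.1 (hpn.trans ((min_le_right _ _).trans (min_le_right _ _)))).2
  set x : Fin n → Fin p → ℝ := fun i => (X i).ofLp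
  set q := (p : ℝ) / n
  have hhi : ∀ i, maronnaPsi u (d - r) ≤ hat x i i ∧ hat x i i ≤ maronnaPsi u (d + r) ∧
      0 < hat x i i := fun i => by
    have := abs_le.1 (hh i)
    refine ⟨by linarith, by linarith, by linarith⟩
  have hanti' : ∀ a ∈ Icc (d - r) (d + r), u (d + r) ≤ u a ∧ u a ≤ u (d - r) := fun a ha =>
    ⟨hanti ha ⟨by linarith, le_rfl⟩ ha.2, hanti ⟨le_rfl, by linarith⟩ ha ha.1⟩
  have hum := hA1.pos _ hm.le
  have huM := hA1.pos (d + r) (by linarith)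
  obtain ⟨huniq, e, heK, hfix, hest⟩ := existsUnique_isMaronnaSolution hA1 hA2 hA
    (fun i => (hhi i).2.2) hm (M := d + r) (by linarith) (fun e he i => by
      have hw : ∀ j, 0 < u (e j) := fun j => hA1.pos _ (hm.le.trans (he j).1)
      constructor
      · refine le_trans ?_ (div_le_mahal hA hw hum (fun j => (hanti' _ (he j)).2) i)
        rw [le_div_iff₀ hum]
        exact (hhi i).1
      · refine (mahal_le_div hA hw huM (fun j => (hanti' _ (he j)).1) i).trans ?_
        rw [div_le_iff₀ huM]
        exact (hhi i).2.1)
  refine ⟨huniq, _, hest, ?_⟩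
  have he0 : ∀ j, 0 < e j := fun j => hm.trans_le (heK j).1
  have hw : ∀ j, 0 < u (e j) := fun j => hA1.pos _ (he0 j).le
  have : Nonempty (Fin n) := ⟨⟨0, by omega⟩⟩
  -- The largest `e` has the smallest weight. As the average of `ψ(e_i)` is `q`, the extremes
  -- satisfy `ψ(e_l) ≤ q ≤ ψ(e_k)`.
  obtain ⟨k, hk⟩ := Finite.exists_max e
  obtain ⟨l, hl⟩ := Finite.exists_min e
  have hψe : ∀ i, u (e i) * mahal x (fun j => u (e j)) i = maronnaPsi u (e i) := fun i => by
    rw [hfix, maronnaPsi, mul_comm]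
  have hsum : ∑ i, maronnaPsi u (e i) = n * q := by
    have h1 := sum_mul_mahal (posDef_scatter hA hw)
    simp_rw [hψe] at h1
    have hn0 : (n : ℝ) ≠ 0 := by positivity
    rw [h1, mul_div_cancel₀ _ hn0]
  have hn0 : (0 : ℝ) < n := by positivity
  have hqk : q ≤ maronnaPsi u (e k) := by
    have h2 : ∑ i, maronnaPsi u (e i) ≤ ∑ _i : Fin n, maronnaPsi u (e k) :=
      Finset.sum_le_sum fun i _ => (hψ (he0 i).le (he0 k).le).2 (hk i)
    rw [hsum, Finset.sum_const, Finset.card_univ, Fintype.card_fin, nsmul_eq_mul] at h2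
    exact le_of_mul_le_mul_left h2 hn0
  have hql : maronnaPsi u (e l) ≤ q := by
    have h2 : ∑ _i : Fin n, maronnaPsi u (e l) ≤ ∑ i, maronnaPsi u (e i) :=
      Finset.sum_le_sum fun i _ => (hψ (he0 l).le (he0 i).le).2 (hl i)
    rw [hsum, Finset.sum_const, Finset.card_univ, Fintype.card_fin, nsmul_eq_mul] at h2
    exact le_of_mul_le_mul_left h2 hn0
  have hwk : ∀ i, u (e k) ≤ u (e i) := fun i => hanti (heK i) (heK k) (hk i)
  have hwl : ∀ i, u (e i) ≤ u (e l) := fun i => hanti (heK l) (heK i) (hl i)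
  have hratio := weights_ratio_le hA hα hε (by linarith) hn hspread hh hw (k := k) (l := l) hwk hwl
    (by rw [hψe]; exact hqk) (by rw [hψe]; exact hql)
  have hball' : ∀ a, |a - d| ≤ η → |u a - u d| ≤ ε * u d := fun a ha => by
    have := hball (x := a) (by rw [Real.dist_eq]; linarith)
    rw [Real.dist_eq] at this
    exact this.le
  have hel : e l ≤ d + η := (hψ (he0 l).le (by linarith)).1 (by linarith)
  have hek : d - η ≤ e k := (hψ (by linarith) (he0 k).le).1 (by linarith)
  have h1 : (1 - ε) * u d ≤ u (e l) := by
    have h2 := hanti (heK l) (⟨by linarith, by linarith⟩ : d + η ∈ Icc (d - r) (d + r)) hel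
    have h3 := (abs_le.1 (hball' (d + η) (by rw [add_sub_cancel_left, abs_of_pos hη]))).1
    linarith
  have h2 : u (e k) ≤ (1 + ε) * u d := by
    have h2 := hanti (⟨by linarith, by linarith⟩ : d - η ∈ Icc (d - r) (d + r)) (heK k) hek
    have h3 := (abs_le.1 (hball' (d - η) (by
      rw [sub_sub_cancel_left, abs_neg, abs_of_pos hη]))).2
    linarith
  intro i
  set ρ := ε / α with hρ
  have hρ0 : 0 < ρ := by positivity
  have hK : (1 + 8 / α) * ε = ε + 8 * ρ := by rw [hρ]; ring
  have hup : u (e i) ≤ (1 + 4 * ρ) * ((1 + ε) * u d) :=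
    (hwl i).trans (hratio.trans (mul_le_mul_of_nonneg_left h2 (by positivity)))
  have hlo : (1 - ε) * u d ≤ (1 + 4 * ρ) * u (e i) :=
    h1.trans (hratio.trans (mul_le_mul_of_nonneg_left (hwk i) (by positivity)))
  rw [hK]
  exact abs_div_sub_one_le hud hε.le hε2.le hρ0.le hup hlo

/-- Location of Maronna's estimator on the event that the leverages are close to their mean and
the hat matrix is well spread. -/
lemma exists_weightsWithin (hy : 0 < y) (hA1 : AssumptionA1 u y) (hA2 : AssumptionA2 u) {α : ℝ}
    (hα : 0 < α) :
    ∃ K c' : ℝ, 0 < K ∧ 0 < c' ∧ ∀ ε, 0 < ε → ε < c' → ∃ δ, 0 < δ ∧ ∀ n p : ℕ, 4 ≤ n →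
      |(p : ℝ) / n - y| ≤ δ → ∀ X : Fin n → EuclideanSpace ℝ (Fin p),
      (scatter (fun i => (X i).ofLp) 1).PosDef →
      (∀ i, |hat (fun i => (X i).ofLp) i i - (p : ℝ) / n| ≤ ε) →
      HatSpread (fun i => (X i).ofLp) α →
      WeightsWithin u y (K * ε) X := by
  obtain ⟨hd, hdy⟩ := maronnaPsiInv_spec hy hA1 hA2
  rcases lt_or_ge 0 (u (maronnaPsiInv u y) +
      maronnaPsiInv u y * derivWithin u (Ici 0) (maronnaPsiInv u y)) with h | h
  · obtain ⟨K, c', hK, hc', H⟩ := weightsWithin_of_contraction hy hA1 hA2 h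
    refine ⟨K, c', hK, hc', fun ε hε hεc => ?_⟩
    obtain ⟨δ, hδ, H'⟩ := H ε hε hεc
    exact ⟨δ, hδ, fun n p _ hpn X hA hh _ => H' n p hpn X hA hh⟩
  -- Since `u(d) > 0`, the inequality `u(d) + d u'(d) ≤ 0` forces `u'(d) < 0`.
  · refine weightsWithin_of_spread hy hA1 hA2 ?_ hα
    have := hA1.pos _ hd.le
    by_contra hcon
    push Not at hcon
    nlinarith [mul_nonneg hd.le hcon]

end Spread

/-! ### Chernoff bounds for quadratic forms of Gaussian vectors. -/

section GaussianQuadratic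

lemma gaussianPDFReal_mul_exp (a x : ℝ) :
    gaussianPDFReal 0 1 x * Real.exp (a * x ^ 2) =
      (√(2 * Real.pi))⁻¹ * Real.exp (-(1 / 2 - a) * x ^ 2) := by
  rw [gaussianPDFReal_def]
  simp only [NNReal.coe_one, mul_one, sub_zero]
  rw [mul_assoc, ← Real.exp_add]
  congr 2
  ring

lemma integrable_exp_mul_sq_gaussianReal {a : ℝ} (ha : a < 1 / 2) :
    Integrable (fun x : ℝ => Real.exp (a * x ^ 2)) (gaussianReal 0 1) := by
  rw [gaussianReal_of_var_ne_zero _ one_ne_zero]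
  rw [integrable_withDensity_iff_integrable_smul' (measurable_gaussianPDF _ _)
    (ae_of_all _ fun _ => gaussianPDF_lt_top)]
  simp only [toReal_gaussianPDF, smul_eq_mul, gaussianPDFReal_mul_exp]
  exact (integrable_exp_neg_mul_sq (by linarith)).const_mul _

lemma integral_exp_mul_sq_gaussianReal {a : ℝ} (ha : a < 1 / 2) :
    ∫ x, Real.exp (a * x ^ 2) ∂(gaussianReal 0 1) = (√(1 - 2 * a))⁻¹ := by
  rw [integral_gaussianReal_eq_integral_smul one_ne_zero]
  simp only [smul_eq_mul, gaussianPDFReal_mul_exp]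
  have h1 : 0 < 1 / 2 - a := by linarith
  rw [integral_const_mul, integral_gaussian, ← Real.sqrt_inv, ← Real.sqrt_inv,
    ← Real.sqrt_mul (by positivity)]
  congr 1
  have h2 : 1 - 2 * a ≠ 0 := by linarith
  have h3 : 1 / 2 - a = (1 - 2 * a) / 2 := by ring
  rw [h3]
  field_simp

variable {n : ℕ}

/-- Chernoff bound for a diagonal quadratic form of independent random variables whose laws are
standard normal. -/
lemma pi_chernoff {α : Fin n → Type*} [∀ i, MeasurableSpace (α i)] (μ : ∀ i, Measure (α i))
    [∀ i, IsProbabilityMeasure (μ i)] {f : ∀ i, α i → ℝ}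
    (hf : ∀ i, MeasurePreserving (f i) (μ i) (gaussianReal 0 1))
    {a : Fin n → ℝ} (ha : ∀ i, a i < 1 / 2) (b : ℝ) :
    Measure.pi μ {x | b ≤ ∑ i, a i * f i (x i) ^ 2} ≤
      ENNReal.ofReal (Real.exp (-b) * ∏ i, (√(1 - 2 * a i))⁻¹) := by
  have hint : ∀ i, Integrable (fun x => Real.exp (a i * f i x ^ 2)) (μ i) := fun i =>
    ((hf i).integrable_comp (integrable_exp_mul_sq_gaussianReal (ha i)).aestronglyMeasurable).2
      (integrable_exp_mul_sq_gaussianReal (ha i))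
  have hval : ∀ i, ∫ x, Real.exp (a i * f i x ^ 2) ∂(μ i) = (√(1 - 2 * a i))⁻¹ := fun i => by
    rw [← integral_exp_mul_sq_gaussianReal (ha i), ← (hf i).map_eq, integral_map
      (hf i).measurable.aemeasurable]
    exact Measurable.aestronglyMeasurable (by fun_prop)
  have hprod := Integrable.fintype_prod_dep (μ := μ)
    (f := fun i x => Real.exp (a i * f i x ^ 2)) hint
  have hprodval := integral_fintype_prod_eq_prod (μ := μ) (𝕜 := ℝ)
    (fun i x => Real.exp (a i * f i x ^ 2))
  simp only [hval] at hprodval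
  have hint' := hprod.const_mul (Real.exp (-b))
  have h0 : ∀ x : ∀ i, α i, 0 ≤ Real.exp (-b) * ∏ i, Real.exp (a i * f i (x i) ^ 2) := fun x =>
    mul_nonneg (Real.exp_pos _).le (Finset.prod_nonneg fun i _ => (Real.exp_pos _).le)
  rw [← hprodval, ← integral_const_mul, ofReal_integral_eq_lintegral_ofReal hint'
    (ae_of_all _ h0)]
  refine meas_le_lintegral₀ hint'.aestronglyMeasurable.aemeasurable.ennreal_ofReal fun x hx => ?_
  rw [ENNReal.one_le_ofReal, ← Real.exp_sum, ← Real.exp_add, Real.one_le_exp_iff]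
  linarith [show b ≤ ∑ i, a i * f i (x i) ^ 2 from hx]

lemma inv_sqrt_one_sub_le {a : ℝ} (ha : |a| ≤ 1 / 4) :
    (√(1 - 2 * a))⁻¹ ≤ Real.exp (a + 4 * a ^ 2) := by
  have ha' := abs_le.1 ha
  have h1 : 0 < 1 - 2 * a := by linarith
  have h2 : (1 - 2 * a)⁻¹ ≤ Real.exp (2 * a + 8 * a ^ 2) := by
    refine le_trans ?_ (Real.add_one_le_exp _)
    rw [inv_le_iff_one_le_mul₀ h1]
    nlinarith [mul_nonneg (sq_nonneg a) (by linarith : 0 ≤ 1 - 4 * a)]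
  rw [← Real.sqrt_inv]
  refine (Real.sqrt_le_sqrt h2).trans (le_of_eq ?_)
  rw [show 2 * a + 8 * a ^ 2 = (a + 4 * a ^ 2) + (a + 4 * a ^ 2) by ring, Real.exp_add,
    Real.sqrt_mul_self (Real.exp_pos _).le]

/-- Only the threshold 0 is needed: the events compare two quadratic forms and are invariant under
scaling of `g`. -/
lemma stdGaussian_chernoff {E : Type*} [NormedAddCommGroup E]
    [InnerProductSpace ℝ E] [FiniteDimensional ℝ E] [MeasurableSpace E] [BorelSpace E]
    (b : OrthonormalBasis (Fin n) ℝ E) {a : Fin n → ℝ} (ha : ∀ i, a i < 1 / 2) :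
    stdGaussian E {g | 0 ≤ ∑ i, a i * (inner ℝ (b i) g) ^ 2} ≤
      ENNReal.ofReal (∏ i, (√(1 - 2 * a i))⁻¹) := by
  rw [stdGaussian_eq_map_pi_orthonormalBasis b, Measure.map_apply (by fun_prop)
    (measurableSet_le (by fun_prop) (by fun_prop))]
  have h := pi_chernoff (fun _ : Fin n => gaussianReal 0 1) (f := fun _ => id)
    (fun _ => MeasurePreserving.id _) ha 0
  rw [neg_zero, Real.exp_zero, one_mul] at h
  refine le_trans (measure_mono fun x hx => ?_) h
  simp only [mem_preimage, mem_ofPred_eq, b.orthonormal.inner_right_fintype] at hx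
  exact hx

/-- Chernoff bound for a quadratic form of a standard Gaussian vector. -/
lemma stdGaussian_quadratic_chernoff {M : Matrix (Fin n) (Fin n) ℝ} (hM : M.IsHermitian)
    (hM2 : ∀ v : Fin n → ℝ, |v ⬝ᵥ (M *ᵥ v)| ≤ 2 * (v ⬝ᵥ v)) {s : ℝ} (hs : 0 < s)
    (hs8 : s ≤ 1 / 8) :
    stdGaussian (EuclideanSpace ℝ (Fin n)) {g | 0 ≤ g.ofLp ⬝ᵥ (M *ᵥ g.ofLp)} ≤
      ENNReal.ofReal (Real.exp (s * M.trace + 16 * s ^ 2 * n)) := by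
  set b := hM.eigenvectorBasis
  set l := hM.eigenvalues
  have hl : ∀ i, |l i| ≤ 2 := fun i => by
    have h1 := hM2 (b i).ofLp
    have h2 : (b i).ofLp ⬝ᵥ (b i).ofLp = 1 := by
      have h3 : ‖b i‖ ^ 2 = 1 := by rw [b.orthonormal.1 i, one_pow]
      rw [EuclideanSpace.real_norm_sq_eq] at h3
      rw [← h3]
      simp [dotProduct, sq]
    rw [hM.mulVec_eigenvectorBasis, dotProduct_smul, h2, smul_eq_mul] at h1
    simpa using h1
  have hquad : ∀ g : EuclideanSpace ℝ (Fin n),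
      g.ofLp ⬝ᵥ (M *ᵥ g.ofLp) = ∑ i, l i * (inner ℝ (b i) g) ^ 2 := by
    intro g
    have h1 : M *ᵥ g.ofLp = ∑ i, inner ℝ (b i) g • (l i • (b i).ofLp) := by
      conv_lhs => rw [← b.sum_repr' g]
      rw [WithLp.ofLp_sum, Matrix.mulVec_sum]
      refine Finset.sum_congr rfl fun i _ => ?_
      rw [WithLp.ofLp_smul, Matrix.mulVec_smul, hM.mulVec_eigenvectorBasis]
    rw [h1, dotProduct_sum]
    refine Finset.sum_congr rfl fun i _ => ?_
    rw [dotProduct_smul, dotProduct_smul, smul_eq_mul, smul_eq_mul]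
    have h2 : g.ofLp ⬝ᵥ (b i).ofLp = inner ℝ (b i) g := by
      simp [PiLp.inner_apply, dotProduct]
    rw [h2]
    ring
  have htr : M.trace = ∑ i, l i := by simpa using hM.trace_eq_sum_eigenvalues
  have hsl : ∀ i, |s * l i| ≤ 1 / 4 := fun i => by
    rw [abs_mul, abs_of_pos hs]
    nlinarith [hl i, abs_nonneg (l i)]
  have h := stdGaussian_chernoff b (a := fun i => s * l i)
    (fun i => by linarith [(abs_le.1 (hsl i)).2])
  have h3 : ∏ i, (√(1 - 2 * (s * l i)))⁻¹ ≤ Real.exp (s * M.trace + 16 * s ^ 2 * n) := by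
    calc _ ≤ ∏ i, Real.exp (s * l i + 16 * s ^ 2) := by
          refine Finset.prod_le_prod (fun i _ => by positivity) fun i _ => ?_
          refine (inv_sqrt_one_sub_le (hsl i)).trans (Real.exp_le_exp.2 ?_)
          have h4 : l i ^ 2 ≤ 4 := by nlinarith [hl i, abs_nonneg (l i), sq_abs (l i)]
          nlinarith [sq_nonneg s]
      _ = _ := by
          rw [← Real.exp_sum, Finset.sum_add_distrib, ← Finset.mul_sum, ← htr]
          simp
          ring
  refine le_trans (measure_mono fun g hg => ?_) (h.trans (ENNReal.ofReal_le_ofReal h3))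
  simp only [mem_ofPred_eq, hquad] at hg ⊢
  have h4 := mul_nonneg hs.le hg
  rw [Finset.mul_sum] at h4
  simpa only [mul_assoc] using h4

/-- The normalized quadratic form of a projection at a standard Gaussian vector concentrates
around the normalized trace. -/
lemma stdGaussian_projection_concentration {P : Matrix (Fin n) (Fin n) ℝ} (hP : P.IsHermitian)
    (hP0 : ∀ v : Fin n → ℝ, 0 ≤ v ⬝ᵥ (P *ᵥ v)) (hP1 : ∀ v : Fin n → ℝ, v ⬝ᵥ (P *ᵥ v) ≤ v ⬝ᵥ v)
    {p : ℕ} (hpn : p ≤ n) (htr : P.trace = p) {ε : ℝ} (hε : 0 < ε) (hε1 : ε ≤ 1) :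
    stdGaussian (EuclideanSpace ℝ (Fin n))
      {g | ε * (g.ofLp ⬝ᵥ g.ofLp) ≤
        |g.ofLp ⬝ᵥ (P *ᵥ g.ofLp) - (p : ℝ) / n * (g.ofLp ⬝ᵥ g.ofLp)|} ≤
      ENNReal.ofReal (2 * Real.exp (-(ε ^ 2 * n / 64))) := by
  have hq0 : 0 ≤ (p : ℝ) / n := by positivity
  have hq1 : (p : ℝ) / n ≤ 1 := div_le_one_of_le₀ (by exact_mod_cast hpn) (by positivity)
  have hqn : (p : ℝ) / n * n = p := by
    rcases Nat.eq_zero_or_pos n with h | h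
    · have : p = 0 := by omega
      simp [this]
    · exact div_mul_cancel₀ _ (by positivity)
  set q := (p : ℝ) / n
  have hvv : ∀ v : Fin n → ℝ, 0 ≤ v ⬝ᵥ v := fun v => by
    rw [dotProduct]; exact Finset.sum_nonneg fun i _ => mul_self_nonneg _
  have key : ∀ σ : ℝ, σ = 1 ∨ σ = -1 → stdGaussian (EuclideanSpace ℝ (Fin n))
      {g | 0 ≤ g.ofLp ⬝ᵥ ((σ • (P - q • 1) - ε • 1 : Matrix _ _ ℝ) *ᵥ g.ofLp)} ≤
      ENNReal.ofReal (Real.exp (-(ε ^ 2 * n / 64))) := by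
    intro σ hσ
    have hquad : ∀ v : Fin n → ℝ, v ⬝ᵥ ((σ • (P - q • 1) - ε • 1 : Matrix _ _ ℝ) *ᵥ v) =
        σ * (v ⬝ᵥ (P *ᵥ v) - q * (v ⬝ᵥ v)) - ε * (v ⬝ᵥ v) := fun v => by
      simp only [Matrix.sub_mulVec, Matrix.smul_mulVec, Matrix.one_mulVec, dotProduct_sub,
        dotProduct_smul, smul_eq_mul]
    have h1 := stdGaussian_quadratic_chernoff (M := σ • (P - q • 1) - ε • 1)
      (by
        refine Matrix.IsHermitian.sub ?_ ?_
        · refine Matrix.IsHermitian.smul (hP.sub ?_) (by simp [IsSelfAdjoint])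
          exact Matrix.isHermitian_one.smul (by simp [IsSelfAdjoint])
        · exact Matrix.isHermitian_one.smul (by simp [IsSelfAdjoint]))
      (fun v => by
        rw [hquad, abs_le]
        have := hP0 v
        have := hP1 v
        have := hvv v
        rcases hσ with rfl | rfl <;> constructor <;> nlinarith)
      -- The trace is `-ε n`, so the exponent is `-s ε n + 16 s² n`. The value `s = ε / 32`
      -- minimises it and gives `-ε² n / 64`.
      (s := ε / 32) (by positivity) (by linarith)
    refine h1.trans (ENNReal.ofReal_le_ofReal (Real.exp_le_exp.2 (le_of_eq ?_)))
    have htr' : (σ • (P - q • 1) - ε • 1 : Matrix (Fin n) (Fin n) ℝ).trace = -(ε * n) := by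
      rw [Matrix.trace_sub, Matrix.trace_smul, Matrix.trace_sub, Matrix.trace_smul,
        Matrix.trace_smul, Matrix.trace_one, Fintype.card_fin, htr]
      simp only [smul_eq_mul, hqn]
      ring
    rw [htr']
    ring
  refine (measure_mono (t := {g | 0 ≤ g.ofLp ⬝ᵥ (((1 : ℝ) • (P - q • 1) - ε • 1 :
    Matrix _ _ ℝ) *ᵥ g.ofLp)} ∪ {g | 0 ≤ g.ofLp ⬝ᵥ (((-1 : ℝ) • (P - q • 1) - ε • 1 :
    Matrix _ _ ℝ) *ᵥ g.ofLp)}) fun g hg => ?_).trans ((measure_union_le _ _).trans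
    ((add_le_add (key 1 (Or.inl rfl)) (key (-1) (Or.inr rfl))).trans (le_of_eq ?_)))
  · simp only [mem_ofPred_eq, mem_union, Matrix.sub_mulVec, Matrix.smul_mulVec, Matrix.one_mulVec,
      dotProduct_sub, dotProduct_smul, smul_eq_mul] at hg ⊢
    rcases le_abs.1 hg with h | h
    · left; linarith
    · right; linarith
  · rw [← ENNReal.ofReal_add (Real.exp_pos _).le (Real.exp_pos _).le, two_mul]

end GaussianQuadratic

/-! ### Almost sure linear independence. -/

section FullRank

lemma measurePreserving_inner_stdGaussian {E : Type*} [NormedAddCommGroup E]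
    [InnerProductSpace ℝ E] [FiniteDimensional ℝ E] [MeasurableSpace E] [BorelSpace E] {v : E}
    (hv : ‖v‖ = 1) :
    MeasurePreserving (fun x => inner ℝ x v) (stdGaussian E) (gaussianReal 0 1) := by
  have h : (fun x : E => inner ℝ x v) = innerSL ℝ v := by
    ext x
    simp [real_inner_comm]
  rw [h]
  refine ⟨by fun_prop, ?_⟩
  rw [IsGaussian.map_eq_gaussianReal, integral_strongDual_stdGaussian, variance_dual_stdGaussian,
    innerSL_apply_norm, hv]
  simp

lemma stdGaussian_submodule {E : Type*} [NormedAddCommGroup E]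
    [InnerProductSpace ℝ E] [FiniteDimensional ℝ E] [MeasurableSpace E] [BorelSpace E]
    {W : Submodule ℝ E} (hW : W ≠ ⊤) : stdGaussian E (W : Set E) = 0 := by
  have h1 : Wᗮ ≠ ⊥ := fun h => hW ((Submodule.orthogonal_eq_bot_iff).1 h)
  obtain ⟨v, hv, hv0⟩ := Submodule.exists_mem_ne_zero_of_ne_bot h1
  have hn : ‖((‖v‖⁻¹ : ℝ)) • v‖ = 1 := by
    rw [norm_smul, norm_inv, norm_norm, inv_mul_cancel₀ (norm_ne_zero_iff.2 hv0)]
  have hmp := measurePreserving_inner_stdGaussian hn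
  have := nullSingletonClass_gaussianReal (μ := 0) (v := 1) one_ne_zero
  refine measure_mono_null (t := (fun x => inner ℝ x ((‖v‖⁻¹ : ℝ) • v)) ⁻¹' {(0 : ℝ)})
    (fun x hx => ?_) ?_
  · rw [mem_preimage, mem_singleton_iff, inner_smul_right, (W.mem_orthogonal v).1 hv x hx, mul_zero]
  · rw [hmp.measure_preimage (measurableSet_singleton _).nullMeasurableSet]
    exact measure_singleton _

lemma pi_ae_linearIndependent {E : Type*} [NormedAddCommGroup E] [NormedSpace ℝ E]
    [FiniteDimensional ℝ E] [MeasurableSpace E] [BorelSpace E] (μ : Measure E) [SigmaFinite μ]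
    (hμ : ∀ W : Submodule ℝ E, W ≠ ⊤ → μ (W : Set E) = 0) :
    ∀ k : ℕ, k ≤ Module.finrank ℝ E →
      ∀ᵐ x ∂(Measure.pi fun _ : Fin k => μ), LinearIndependent ℝ x := by
  intro k
  induction k with
  | zero => exact fun _ => ae_of_all _ fun x => linearIndependent_empty_type
  | succ k ih =>
    intro hk
    have ih' := ih (by omega)
    have hmp := (measurePreserving_piFinSuccAbove (fun _ : Fin (k + 1) => μ) 0).symm
    have hmeas : MeasurableSet {x : Fin (k + 1) → E | LinearIndependent ℝ x} :=
      isOpen_setOfPred_linearIndependent.measurableSet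
    rw [← hmp.map_eq, ae_map_iff hmp.measurable.aemeasurable hmeas]
    have hmeas' : MeasurableSet {x : E × (Fin k → E) | LinearIndependent ℝ
        ((MeasurableEquiv.piFinSuccAbove (fun _ : Fin (k + 1) => E) 0).symm (x.1, x.2))} :=
      hmp.measurable hmeas
    refine (Measure.ae_prod_iff_ae_ae hmeas').2 ((Measure.ae_ae_comm hmeas').2 ?_)
    filter_upwards [ih'] with z hz
    -- Fewer vectors than the dimension span a proper subspace, which is null, so an independent
    -- further vector almost surely avoids it.
    have hspan : Submodule.span ℝ (Set.range z) ≠ ⊤ := by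
      intro h
      have h1 := finrank_span_eq_card hz
      rw [h, finrank_top, Fintype.card_fin] at h1
      omega
    have h2 : ∀ᵐ x ∂μ, x ∉ Submodule.span ℝ (Set.range z) := by
      rw [ae_iff]
      simpa using hμ _ hspan
    filter_upwards [h2] with x hx
    have h3 : (MeasurableEquiv.piFinSuccAbove (fun _ : Fin (k + 1) => E) 0).symm (x, z) =
        Fin.cons x z := by
      simp [MeasurableEquiv.piFinSuccAbove_symm_apply, Fin.insertNthEquiv]
    change LinearIndependent ℝ ((MeasurableEquiv.piFinSuccAbove (fun _ => E) 0).symm (x, z))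
    rw [h3, linearIndependent_finCons]
    exact ⟨hz, hx⟩

end FullRank

/-! ### The Gaussian sample and its invariance under orthogonal mixing. -/

section Sample

variable {n p : ℕ}

/-- The law of an i.i.d. sample of size `n` from `N(0, I)` on `ℝᵖ`. -/
noncomputable def gaussSample (n p : ℕ) : Measure (Fin n → EuclideanSpace ℝ (Fin p)) :=
  Measure.pi fun _ => stdGaussian (EuclideanSpace ℝ (Fin p))

instance : IsProbabilityMeasure (gaussSample n p) := by
  unfold gaussSample; infer_instance

lemma IsGaussianSample.aemeasurable {Ω : Type*} [MeasurableSpace Ω] {μ : Measure Ω}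
    {X : Fin n → Ω → EuclideanSpace ℝ (Fin p)} (h : IsGaussianSample μ X) :
    AEMeasurable (fun ω i => X i ω) μ :=
  aemeasurable_pi_lambda _ fun i => (h.law i).aemeasurable

lemma IsGaussianSample.map_eq {Ω : Type*} [MeasurableSpace Ω] {μ : Measure Ω}
    [IsProbabilityMeasure μ] {X : Fin n → Ω → EuclideanSpace ℝ (Fin p)}
    (h : IsGaussianSample μ X) : μ.map (fun ω i => X i ω) = gaussSample n p := by
  rw [(iIndepFun_iff_map_fun_eq_pi_map fun i => (h.law i).aemeasurable).1 h.indep, gaussSample]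
  congr 1
  funext i
  exact (h.law i).map_eq

/-- The data matrix of a sample, as a family of rows. -/
def dataRows (X : Fin n → EuclideanSpace ℝ (Fin p)) : Fin n → Fin p → ℝ := fun i => (X i).ofLp

lemma ae_posDef_scatter (hpn : p ≤ n) :
    ∀ᵐ X ∂(gaussSample n p), (scatter (dataRows X) 1).PosDef := by
  have h1 := pi_ae_linearIndependent (stdGaussian (EuclideanSpace ℝ (Fin p)))
    (fun W hW => stdGaussian_submodule hW) p (by simp)
  have hind : iIndepFun (fun (i : Fin n) (X : Fin n → EuclideanSpace ℝ (Fin p)) => X i)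
      (gaussSample n p) :=
    iIndepFun_pi (X := fun _ x => x) fun _ => aemeasurable_id
  have hsub : IsGaussianSample (gaussSample n p)
      (fun (i : Fin p) (X : Fin n → EuclideanSpace ℝ (Fin p)) => X (Fin.castLE hpn i)) :=
    ⟨fun i => ⟨(measurable_pi_apply _).aemeasurable,
      (measurePreserving_eval (fun _ : Fin n => stdGaussian (EuclideanSpace ℝ (Fin p))) _).map_eq⟩,
      hind.precomp (Fin.castLE_injective hpn)⟩
  change ∀ᵐ x ∂(gaussSample p p), LinearIndependent ℝ x at h1
  rw [← hsub.map_eq] at h1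
  filter_upwards [ae_of_ae_map hsub.aemeasurable h1] with X hX
  rw [posDef_scatter_iff]
  intro v hv
  simp only [Pi.one_apply, one_mul]
  refine lt_of_le_of_ne (Finset.sum_nonneg fun i _ => sq_nonneg _) fun h0 => hv ?_
  have h2 := (Finset.sum_eq_zero_iff_of_nonneg fun i _ => sq_nonneg _).1 h0.symm
  have hspan := hX.span_eq_top_of_card_eq_finrank' (by simp)
  have h3 : ∀ z ∈ Submodule.span ℝ (Set.range fun i : Fin p => X (Fin.castLE hpn i)),
      inner ℝ z (WithLp.toLp 2 v) = 0 := by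
    intro z hz
    induction hz using Submodule.span_induction with
    | mem z hz =>
      obtain ⟨i, rfl⟩ := hz
      have h4 : (X (Fin.castLE hpn i)).ofLp ⬝ᵥ v = 0 := by
        simpa [dataRows] using h2 (Fin.castLE hpn i) (Finset.mem_univ _)
      rw [dotProduct_comm] at h4
      simpa [PiLp.inner_apply, dotProduct] using h4
    | zero => simp
    | add a b _ _ ha hb => rw [inner_add_left, ha, hb, add_zero]
    | smul c a _ ha => rw [inner_smul_left, ha, mul_zero]
  have h5 := h3 (WithLp.toLp 2 v) (by rw [hspan]; trivial)
  simpa using h5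

/-- The action of a matrix on samples, by mixing the observations. -/
noncomputable def mix (O : Matrix (Fin n) (Fin n) ℝ) (X : Fin n → EuclideanSpace ℝ (Fin p)) :
    Fin n → EuclideanSpace ℝ (Fin p) := fun i => ∑ j, O i j • X j

@[fun_prop]
lemma continuous_mix (O : Matrix (Fin n) (Fin n) ℝ) : Continuous (mix (p := p) O) := by
  unfold mix
  fun_prop

lemma dataRows_mix (O : Matrix (Fin n) (Fin n) ℝ) (X : Fin n → EuclideanSpace ℝ (Fin p)) :
    Matrix.of (dataRows (mix O X)) = O * Matrix.of (dataRows X) := by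
  ext i k
  simp [dataRows, mix, Matrix.mul_apply]

lemma sum_norm_sq_mix {O : Matrix (Fin n) (Fin n) ℝ} (hO : Oᵀ * O = 1)
    (X : Fin n → EuclideanSpace ℝ (Fin p)) : ∑ i, ‖mix O X i‖ ^ 2 = ∑ i, ‖X i‖ ^ 2 := by
  have h : ∀ Y : Fin n → EuclideanSpace ℝ (Fin p), ∑ i, ‖Y i‖ ^ 2 =
      ((Matrix.of (dataRows Y))ᵀ * Matrix.of (dataRows Y)).trace := fun Y => by
    simp only [EuclideanSpace.real_norm_sq_eq, Matrix.trace, Matrix.diag, Matrix.mul_apply,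
      Matrix.transpose_apply, Matrix.of_apply, dataRows]
    rw [Finset.sum_comm]
    simp only [sq]
  rw [h, h, dataRows_mix, Matrix.transpose_mul, Matrix.mul_assoc, ← Matrix.mul_assoc Oᵀ, hO,
    Matrix.one_mul]

/-- The joint characteristic function depends only on the sum of the squared norms of the
frequencies, which orthogonal mixing preserves. -/
lemma measurePreserving_mix {O : Matrix (Fin n) (Fin n) ℝ} (hO : Oᵀ * O = 1) :
    MeasurePreserving (mix (p := p) O) (gaussSample n p) (gaussSample n p) := by
  have hmeas : Measurable (mix (p := p) O) := (continuous_mix O).measurable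
  refine ⟨hmeas, ?_⟩
  have : IsFiniteMeasure ((gaussSample n p).map (mix O)) :=
    Measure.isFiniteMeasure_map _ _
  conv_rhs => rw [gaussSample]
  rw [← charFun_eq_pi_iff]
  intro t
  have hO' : Oᵀᵀ * Oᵀ = 1 := by rw [Matrix.transpose_transpose, mul_eq_one_comm.1 hO]
  have h1 : charFun (((gaussSample n p).map (mix O)).map (WithLp.toLp 2)) t =
      charFun ((gaussSample n p).map (WithLp.toLp 2)) (WithLp.toLp 2 (mix Oᵀ t.ofLp)) := by
    rw [charFun_apply, charFun_apply, integral_map (by fun_prop) (by fun_prop),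
      integral_map (by fun_prop) (by fun_prop), integral_map (by fun_prop) (by fun_prop)]
    refine integral_congr_ae (ae_of_all _ fun X => ?_)
    simp only [PiLp.inner_apply, mix, sum_inner, inner_sum, inner_smul_left, inner_smul_right,
      Matrix.transpose_apply]
    rw [Finset.sum_comm]
    simp
  rw [h1, gaussSample, charFun_pi]
  simp only [charFun_stdGaussian, ← Complex.exp_sum]
  congr 1
  have h2 := sum_norm_sq_mix hO' t.ofLp
  rw [← Finset.sum_div, ← Finset.sum_div, Finset.sum_neg_distrib, Finset.sum_neg_distrib]
  congr 2
  exact_mod_cast h2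

end Sample

/-! ### The hat matrix as a random projection; concentration of the leverages. -/

section HatMatrix

variable {n p : ℕ}

/-- The hat matrix of a sample. -/
noncomputable def hatMatrix (X : Fin n → EuclideanSpace ℝ (Fin p)) : Matrix (Fin n) (Fin n) ℝ :=
  Matrix.of (hat (dataRows X))

lemma scatter_one_eq (x : Fin n → Fin p → ℝ) :
    scatter x 1 = (Matrix.of x)ᵀ * Matrix.of x := by
  ext k l
  simp [scatter, Matrix.mul_apply, Matrix.sum_apply, Matrix.vecMulVec_apply]

lemma hatMatrix_eq (X : Fin n → EuclideanSpace ℝ (Fin p)) :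
    hatMatrix X = Matrix.of (dataRows X) * (scatter (dataRows X) 1)⁻¹ *
      (Matrix.of (dataRows X))ᵀ := by
  ext i j
  rw [Matrix.mul_assoc]
  simp [hatMatrix, hat, Matrix.mul_apply, dotProduct, Matrix.mulVec]

lemma hatMatrix_mix {O : Matrix (Fin n) (Fin n) ℝ} (hO : Oᵀ * O = 1)
    (X : Fin n → EuclideanSpace ℝ (Fin p)) : hatMatrix (mix O X) = O * hatMatrix X * Oᵀ := by
  have h : scatter (dataRows (mix O X)) 1 = scatter (dataRows X) 1 := by
    rw [scatter_one_eq, scatter_one_eq, dataRows_mix, Matrix.transpose_mul, Matrix.mul_assoc,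
      ← Matrix.mul_assoc Oᵀ, hO, Matrix.one_mul]
  rw [hatMatrix_eq, hatMatrix_eq, h, dataRows_mix, Matrix.transpose_mul]
  simp only [Matrix.mul_assoc]

/-- By Cramer's rule the entry is a continuous function times the inverse of a determinant, which is
measurable even where the determinant vanishes. -/
lemma measurable_hatMatrix (i j : Fin n) :
    Measurable fun X : Fin n → EuclideanSpace ℝ (Fin p) => hatMatrix X i j := by
  have hrow : ∀ i, Continuous fun X : Fin n → EuclideanSpace ℝ (Fin p) => dataRows X i := by
    intro i
    unfold dataRows
    fun_prop
  have hA : Continuous fun X : Fin n → EuclideanSpace ℝ (Fin p) => scatter (dataRows X) 1 := by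
    unfold scatter
    refine continuous_finsetSum _ fun i _ => ?_
    simp only [Pi.one_apply, one_smul]
    exact (hrow i).matrix_vecMulVec (hrow i)
  have h : (fun X : Fin n → EuclideanSpace ℝ (Fin p) => hatMatrix X i j) = fun X =>
      ((scatter (dataRows X) 1).det)⁻¹ *
        (dataRows X i ⬝ᵥ ((scatter (dataRows X) 1).adjugate *ᵥ dataRows X j)) := by
    funext X
    rw [hatMatrix, Matrix.of_apply, hat, Matrix.inv_def, Matrix.smul_mulVec, dotProduct_smul,
      Ring.inverse_eq_inv', smul_eq_mul]
  rw [h]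
  refine hA.matrix_det.measurable.inv.mul (Continuous.measurable ?_)
  exact (hrow i).dotProduct (hA.matrix_adjugate.matrix_mulVec (hrow j))

lemma hatMatrix_isHermitian {X : Fin n → EuclideanSpace ℝ (Fin p)}
    (hA : (scatter (dataRows X) 1).PosDef) : (hatMatrix X).IsHermitian := by
  ext i j
  simpa [hatMatrix] using hat_comm hA j i

lemma hatMatrix_mul_self {X : Fin n → EuclideanSpace ℝ (Fin p)}
    (hA : (scatter (dataRows X) 1).PosDef) : hatMatrix X * hatMatrix X = hatMatrix X := by
  have h := Matrix.nonsing_inv_mul _ ((Matrix.isUnit_iff_isUnit_det _).1 hA.isUnit)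
  have h2 : (Matrix.of (dataRows X))ᵀ * Matrix.of (dataRows X) = scatter (dataRows X) 1 :=
    (scatter_one_eq _).symm
  rw [hatMatrix_eq]
  set B := Matrix.of (dataRows X)
  set A := scatter (dataRows X) 1
  calc B * A⁻¹ * Bᵀ * (B * A⁻¹ * Bᵀ) = B * (A⁻¹ * (Bᵀ * B)) * (A⁻¹ * Bᵀ) := by
        simp only [Matrix.mul_assoc]
    _ = B * A⁻¹ * Bᵀ := by rw [h2, h, Matrix.mul_one, Matrix.mul_assoc]

lemma hatMatrix_quad {X : Fin n → EuclideanSpace ℝ (Fin p)}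
    (hA : (scatter (dataRows X) 1).PosDef) (v : Fin n → ℝ) :
    v ⬝ᵥ (hatMatrix X *ᵥ v) = (hatMatrix X *ᵥ v) ⬝ᵥ (hatMatrix X *ᵥ v) := by
  conv_lhs => rw [← hatMatrix_mul_self hA, ← Matrix.mulVec_mulVec]
  rw [dotProduct_mulVec_symm (hatMatrix_isHermitian hA)]

lemma zero_le_dotProduct_self (v : Fin n → ℝ) : 0 ≤ v ⬝ᵥ v :=
  Finset.sum_nonneg fun _ _ => mul_self_nonneg _

lemma hatMatrix_quad_le {X : Fin n → EuclideanSpace ℝ (Fin p)}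
    (hA : (scatter (dataRows X) 1).PosDef) (v : Fin n → ℝ) :
    v ⬝ᵥ (hatMatrix X *ᵥ v) ≤ v ⬝ᵥ v := by
  have h1 := zero_le_dotProduct_self (v - hatMatrix X *ᵥ v)
  rw [sub_dotProduct, dotProduct_sub, dotProduct_sub, ← hatMatrix_quad hA,
    dotProduct_comm (hatMatrix X *ᵥ v) v] at h1
  linarith

lemma hatMatrix_trace {X : Fin n → EuclideanSpace ℝ (Fin p)}
    (hA : (scatter (dataRows X) 1).PosDef) : (hatMatrix X).trace = p := by
  rw [← sum_mul_mahal hA]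
  simp [Matrix.trace, hatMatrix, mahal_one]

/-- Householder reflections: a symmetric orthogonal matrix exchanging two vectors of the same
length and fixing everything orthogonal to both. -/
lemma exists_reflection {a b : Fin n → ℝ} (hab : a ⬝ᵥ a = b ⬝ᵥ b) :
    ∃ O : Matrix (Fin n) (Fin n) ℝ, Oᵀ = O ∧ O * O = 1 ∧ O *ᵥ a = b ∧
      ∀ v, v ⬝ᵥ a = 0 → v ⬝ᵥ b = 0 → O *ᵥ v = v := by
  rcases eq_or_ne a b with rfl | hne
  · exact ⟨1, by simp, by simp, by simp, by simp⟩
  set w := a - b with hw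
  have hw0 : w ⬝ᵥ w ≠ 0 := by
    rw [Ne, dotProduct_self_eq_zero]
    exact sub_ne_zero.2 hne
  have hact : ∀ v, (1 - (2 / (w ⬝ᵥ w)) • Matrix.vecMulVec w w) *ᵥ v =
      v - (2 / (w ⬝ᵥ w) * (w ⬝ᵥ v)) • w := fun v => by
    rw [Matrix.sub_mulVec, Matrix.one_mulVec, Matrix.smul_mulVec, Matrix.vecMulVec_mulVec]
    ext i
    simp
    ring
  refine ⟨1 - (2 / (w ⬝ᵥ w)) • Matrix.vecMulVec w w, ?_, ?_, ?_, fun v h1 h2 => ?_⟩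
  · rw [Matrix.transpose_sub, Matrix.transpose_one, Matrix.transpose_smul,
      Matrix.transpose_vecMulVec]
  · have h : Matrix.vecMulVec w w * Matrix.vecMulVec w w = (w ⬝ᵥ w) • Matrix.vecMulVec w w := by
      rw [Matrix.vecMulVec_mul_vecMulVec]
      ext i j
      simp [Matrix.vecMulVec_apply]
      ring
    simp only [Matrix.sub_mul, Matrix.mul_sub, Matrix.one_mul, Matrix.mul_one,
      Matrix.smul_mul, Matrix.mul_smul, h, smul_smul]
    rw [div_mul_cancel₀ _ hw0]
    module
  · rw [hact]
    have h4 : 2 / (w ⬝ᵥ w) * (w ⬝ᵥ a) = 1 := by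
      have h5 : w ⬝ᵥ w = 2 * (w ⬝ᵥ a) := by
        simp only [hw, sub_dotProduct, dotProduct_sub]
        rw [dotProduct_comm a b, ← hab]
        ring
      rw [div_mul_eq_mul_div, ← h5, div_self hw0]
    rw [h4, one_smul, hw, sub_sub_cancel]
  · rw [hact]
    have h4 : w ⬝ᵥ v = 0 := by
      rw [dotProduct_comm, hw, dotProduct_sub, h1, h2, sub_zero]
    rw [h4, mul_zero, zero_smul, sub_zero]

lemma stdGaussian_dotProduct_pos (hn : 0 < n) :
    ∀ᵐ g ∂(stdGaussian (EuclideanSpace ℝ (Fin n))), 0 < g.ofLp ⬝ᵥ g.ofLp := by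
  have : Nonempty (Fin n) := ⟨⟨0, hn⟩⟩
  have h : stdGaussian (EuclideanSpace ℝ (Fin n))
      ((⊥ : Submodule ℝ (EuclideanSpace ℝ (Fin n))) : Set _) = 0 :=
    stdGaussian_submodule bot_ne_top
  have h2 : ∀ᵐ g ∂(stdGaussian (EuclideanSpace ℝ (Fin n))), g ≠ 0 := by
    rw [ae_iff]
    simpa using h
  filter_upwards [h2] with g hg
  refine lt_of_le_of_ne (zero_le_dotProduct_self _) (Ne.symm ?_)
  rw [Ne, dotProduct_self_eq_zero]
  simpa using hg

/-- Concentration of the leverages. -/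
lemma gaussSample_leverage (hpn : p ≤ n) {ε : ℝ} (hε : 0 < ε) (hε1 : ε ≤ 1) (i : Fin n) :
    gaussSample n p {X | ε ≤ |hatMatrix X i i - (p : ℝ) / n|} ≤
      ENNReal.ofReal (2 * Real.exp (-(ε ^ 2 * n / 64))) := by
  set q := (p : ℝ) / n
  set γ := gaussSample n p
  set G := stdGaussian (EuclideanSpace ℝ (Fin n))
  set S : Set ((Fin n → EuclideanSpace ℝ (Fin p)) × EuclideanSpace ℝ (Fin n)) :=
    {z | ε * (z.2.ofLp ⬝ᵥ z.2.ofLp) ≤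
      |z.2.ofLp ⬝ᵥ (hatMatrix z.1 *ᵥ z.2.ofLp) - q * (z.2.ofLp ⬝ᵥ z.2.ofLp)|} with hS
  have hbad : MeasurableSet {X : Fin n → EuclideanSpace ℝ (Fin p) |
      ε ≤ |hatMatrix X i i - q|} :=
    measurableSet_le measurable_const ((measurable_hatMatrix i i).sub_const q).abs
  have hcoord : ∀ j, Measurable fun z : (Fin n → EuclideanSpace ℝ (Fin p)) ×
      EuclideanSpace ℝ (Fin n) => z.2.ofLp j := fun j => by fun_prop
  have hsq : Measurable fun z : (Fin n → EuclideanSpace ℝ (Fin p)) ×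
      EuclideanSpace ℝ (Fin n) => z.2.ofLp ⬝ᵥ z.2.ofLp := by
    simp only [dotProduct]
    exact Finset.measurable_sum _ fun j _ => (hcoord j).mul (hcoord j)
  have hSmeas : MeasurableSet S := by
    refine measurableSet_le (hsq.const_mul ε) (Measurable.sub ?_ (hsq.const_mul q)).abs
    simp only [dotProduct, Matrix.mulVec]
    refine Finset.measurable_sum _ fun j _ => (hcoord j).mul (Finset.measurable_sum _ fun k _ => ?_)
    exact ((measurable_hatMatrix j k).comp measurable_fst).mul (hcoord k)
  -- A reflection carries `g` to a multiple of the `i`-th basis vector and conjugates `H` without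
  -- changing its law. Hence for each fixed nonzero `g`, `gᵀHg / gᵀg` has the law of `h_ii`.
  have hslice : ∀ g : EuclideanSpace ℝ (Fin n), 0 < g.ofLp ⬝ᵥ g.ofLp →
      γ ((fun X => (X, g)) ⁻¹' S) = γ {X | ε ≤ |hatMatrix X i i - q|} := by
    intro g hg
    set r := √(g.ofLp ⬝ᵥ g.ofLp) with hr
    have hrr : r * r = g.ofLp ⬝ᵥ g.ofLp := Real.mul_self_sqrt hg.le
    obtain ⟨O, hOt, hOO, hOg, -⟩ := exists_reflection (a := g.ofLp) (b := r • Pi.single i 1)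
      (by simp [hrr])
    have hO : Oᵀ * O = 1 := by rw [hOt, hOO]
    rw [← (measurePreserving_mix hO).measure_preimage hbad.nullMeasurableSet]
    congr 1
    ext X
    have hOr : O *ᵥ (r • Pi.single i 1) = g.ofLp := by
      rw [← hOg, Matrix.mulVec_mulVec, hOO, Matrix.one_mulVec]
    have hdiag : ∀ M : Matrix (Fin n) (Fin n) ℝ,
        (r • Pi.single i 1) ⬝ᵥ (M *ᵥ (r • Pi.single i 1)) = r * r * M i i := fun M => by
      simp [Matrix.mulVec_smul, mul_assoc]
    have hq : (g.ofLp ⬝ᵥ (hatMatrix X *ᵥ g.ofLp)) = r * r * hatMatrix (mix O X) i i := by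
      rw [← hdiag, hatMatrix_mix hO, hOt, ← Matrix.mulVec_mulVec, hOr, ← Matrix.mulVec_mulVec,
        Matrix.dotProduct_mulVec _ O, ← Matrix.mulVec_transpose, hOt, hOr]
    simp only [mem_preimage, hS, mem_ofPred_eq]
    rw [hq, ← hrr, show r * r * hatMatrix (mix O X) i i - q * (r * r) =
      (r * r) * (hatMatrix (mix O X) i i - q) by ring, abs_mul, abs_of_pos (hrr ▸ hg),
      mul_comm ε]
    exact mul_le_mul_iff_right₀ (hrr ▸ hg)
  -- Average over an independent Gaussian `g` and exchange the integrals: for fixed `X`, `H` is a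
  -- projection of trace `p` and only `g` is random.
  calc γ {X | ε ≤ |hatMatrix X i i - q|}
      = ∫⁻ _g, γ {X | ε ≤ |hatMatrix X i i - q|} ∂G := by simp
    _ = ∫⁻ g, γ ((fun X => (X, g)) ⁻¹' S) ∂G := by
        refine lintegral_congr_ae ?_
        filter_upwards [stdGaussian_dotProduct_pos i.pos] with g hg
        exact (hslice g hg).symm
    _ = (γ.prod G) S := (Measure.prod_apply_symm hSmeas).symm
    _ = ∫⁻ X, G (Prod.mk X ⁻¹' S) ∂γ := Measure.prod_apply hSmeas
    _ ≤ ∫⁻ _X, ENNReal.ofReal (2 * Real.exp (-(ε ^ 2 * n / 64))) ∂γ := by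
        refine lintegral_mono_ae ?_
        filter_upwards [ae_posDef_scatter hpn] with X hX
        exact stdGaussian_projection_concentration (hatMatrix_isHermitian hX)
          (fun v => by rw [hatMatrix_quad hX]; exact zero_le_dotProduct_self _)
          (hatMatrix_quad_le hX) hpn (hatMatrix_trace hX) hε hε1
    _ = _ := by simp

end HatMatrix

/-! ### Rotational symmetry of the rows of the hat matrix, and their spread. -/

section Spherical

variable {n p : ℕ}

/-- The orthogonal projection killing the `i`-th coordinate. -/
noncomputable def zeroCoord (i : Fin n) (v : EuclideanSpace ℝ (Fin n)) :
    EuclideanSpace ℝ (Fin n) := WithLp.toLp 2 (Function.update v.ofLp i 0)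

@[fun_prop]
lemma continuous_zeroCoord (i : Fin n) : Continuous (zeroCoord i) := by
  unfold zeroCoord
  refine (PiLp.continuous_toLp 2 _).comp ?_
  exact (PiLp.continuous_ofLp 2 _).update i continuous_const

lemma zeroCoord_self (i : Fin n) (v : EuclideanSpace ℝ (Fin n)) : zeroCoord i v i = 0 := by
  simp [zeroCoord]

lemma zeroCoord_of_ne {i j : Fin n} (h : j ≠ i) (v : EuclideanSpace ℝ (Fin n)) :
    zeroCoord i v j = v j := by
  simp [zeroCoord, h]

lemma inner_zeroCoord (i : Fin n) (v w : EuclideanSpace ℝ (Fin n)) :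
    inner ℝ (zeroCoord i v) w = inner ℝ v (zeroCoord i w) := by
  simp only [PiLp.inner_apply]
  refine Finset.sum_congr rfl fun j _ => ?_
  rcases eq_or_ne j i with rfl | h
  · simp [zeroCoord_self]
  · rw [zeroCoord_of_ne h, zeroCoord_of_ne h]

lemma zeroCoord_eq_self {i : Fin n} {v : EuclideanSpace ℝ (Fin n)} (h : v i = 0) :
    zeroCoord i v = v := by
  ext j
  rcases eq_or_ne j i with rfl | hj
  · rw [zeroCoord_self, h]
  · rw [zeroCoord_of_ne hj]

lemma norm_sq_zeroCoord (i : Fin n) (v : EuclideanSpace ℝ (Fin n)) :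
    ‖zeroCoord i v‖ ^ 2 = ∑ j ∈ Finset.univ.erase i, v j ^ 2 := by
  rw [EuclideanSpace.real_norm_sq_eq, ← Finset.add_sum_erase _ _ (Finset.mem_univ i),
    zeroCoord_self, zero_pow two_ne_zero, zero_add]
  exact Finset.sum_congr rfl fun j hj => by rw [zeroCoord_of_ne (Finset.ne_of_mem_erase hj)]

/-- A measure whose characteristic function is radial on the hyperplane `v i = 0`, and which is
carried by this hyperplane. -/
structure IsRadial (i : Fin n) (ν : Measure (EuclideanSpace ℝ (Fin n))) : Prop where
  charFun_eq : ∀ θ θ' : EuclideanSpace ℝ (Fin n), ‖θ‖ = ‖θ'‖ → θ i = 0 → θ' i = 0 →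
    charFun ν θ = charFun ν θ'
  ae_eq_zero : ∀ᵐ v ∂ν, v i = 0

/-- On the hyperplane only the projection of the frequency counts, and both projected frequencies
have norm `‖w‖ ‖zeroCoord i θ‖`. -/
lemma IsRadial.charFun_smul {i : Fin n} {ν : Measure (EuclideanSpace ℝ (Fin n))}
    (h : IsRadial i ν) (θ : EuclideanSpace ℝ (Fin n)) {w : EuclideanSpace ℝ (Fin n)}
    (hw : w i = 0) : charFun ν (‖w‖ • θ) = charFun ν (‖zeroCoord i θ‖ • w) := by
  have h1 : charFun ν (‖w‖ • θ) = charFun ν (‖w‖ • zeroCoord i θ) := by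
    rw [charFun_apply, charFun_apply]
    refine integral_congr_ae ?_
    filter_upwards [h.ae_eq_zero] with v hv
    rw [inner_smul_right, inner_smul_right, ← inner_zeroCoord, zeroCoord_eq_self hv]
  rw [h1]
  refine h.charFun_eq _ _ ?_ ?_ ?_
  · rw [norm_smul, norm_smul, norm_norm, norm_norm, mul_comm]
  · simp [zeroCoord_self]
  · simp [hw]

/-- A substitute for polar decomposition: for independent `V ~ ν` and `W ~ ν'`, the vectors `‖W‖ V`
and `‖V‖ W` have the same law, since radiality turns both characteristic functions at `θ` into the
expectation of `exp(i ‖Pθ‖ ⟨V, W⟩)`, with `P` the projection `zeroCoord i`. -/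
lemma IsRadial.map_prod_eq {i : Fin n} {ν ν' : Measure (EuclideanSpace ℝ (Fin n))}
    [IsProbabilityMeasure ν] [IsProbabilityMeasure ν'] (h : IsRadial i ν) (h' : IsRadial i ν') :
    (ν.prod ν').map (fun z => ‖z.2‖ • z.1) = (ν.prod ν').map (fun z => ‖z.1‖ • z.2) := by
  have hm1 : Measurable fun z : EuclideanSpace ℝ (Fin n) × EuclideanSpace ℝ (Fin n) =>
      ‖z.2‖ • z.1 := by fun_prop
  have hm2 : Measurable fun z : EuclideanSpace ℝ (Fin n) × EuclideanSpace ℝ (Fin n) =>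
      ‖z.1‖ • z.2 := by fun_prop
  have : IsProbabilityMeasure ((ν.prod ν').map fun z => ‖z.2‖ • z.1) :=
    Measure.isProbabilityMeasure_map hm1.aemeasurable
  have : IsProbabilityMeasure ((ν.prod ν').map fun z => ‖z.1‖ • z.2) :=
    Measure.isProbabilityMeasure_map hm2.aemeasurable
  have hint : ∀ f : EuclideanSpace ℝ (Fin n) × EuclideanSpace ℝ (Fin n) → ℝ, Continuous f →
      Integrable (fun z => Complex.exp (f z * Complex.I)) (ν.prod ν') := fun f hf => by
    refine Integrable.of_bound (C := 1) (Continuous.aestronglyMeasurable (by fun_prop))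
      (ae_of_all _ fun z => ?_)
    rw [Complex.norm_exp_ofReal_mul_I]
  apply Measure.ext_of_charFun
  funext θ
  have h1 : charFun ((ν.prod ν').map fun z => ‖z.2‖ • z.1) θ =
      ∫ w, charFun ν (‖zeroCoord i θ‖ • w) ∂ν' := by
    rw [charFun_apply, integral_map hm1.aemeasurable (by fun_prop),
      integral_prod_symm _ (hint (fun z => inner ℝ (‖z.2‖ • z.1) θ) (by fun_prop))]
    refine integral_congr_ae ?_
    filter_upwards [h'.ae_eq_zero] with w hw
    rw [← h.charFun_smul θ hw, charFun_apply]
    simp only [real_inner_smul_left, real_inner_smul_right]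
  have h2 : charFun ((ν.prod ν').map fun z => ‖z.1‖ • z.2) θ =
      ∫ v, charFun ν' (‖zeroCoord i θ‖ • v) ∂ν := by
    rw [charFun_apply, integral_map hm2.aemeasurable (by fun_prop),
      integral_prod _ (hint (fun z => inner ℝ (‖z.1‖ • z.2) θ) (by fun_prop))]
    refine integral_congr_ae ?_
    filter_upwards [h.ae_eq_zero] with v hv
    rw [← h'.charFun_smul θ hv, charFun_apply]
    simp only [real_inner_smul_left, real_inner_smul_right]
  rw [h1, h2]
  simp only [charFun_apply, real_inner_smul_right]
  rw [← integral_prod_symm (fun z : EuclideanSpace ℝ (Fin n) × EuclideanSpace ℝ (Fin n) =>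
      Complex.exp (((‖zeroCoord i θ‖ * inner ℝ z.1 z.2 : ℝ) : ℂ) * Complex.I))
      (hint (fun z => ‖zeroCoord i θ‖ * inner ℝ z.1 z.2) (by fun_prop)),
    integral_prod _ (hint (fun z => ‖zeroCoord i θ‖ * inner ℝ z.1 z.2) (by fun_prop))]
  simp only [real_inner_comm]

/-- Radial measures give the same mass to cones, up to the mass of the origin. -/
lemma IsRadial.measure_cone_le {i : Fin n} {ν ν' : Measure (EuclideanSpace ℝ (Fin n))}
    [IsProbabilityMeasure ν] [IsProbabilityMeasure ν'] (h : IsRadial i ν) (h' : IsRadial i ν')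
    (hν' : ∀ᵐ w ∂ν', w ≠ 0) {D : Set (EuclideanSpace ℝ (Fin n))} (hD : MeasurableSet D)
    (hsmul : ∀ c : ℝ, 0 < c → ∀ v, c • v ∈ D ↔ v ∈ D) (h0 : (0 : EuclideanSpace ℝ (Fin n)) ∉ D) :
    ν D ≤ ν' D := by
  have hm1 : Measurable fun z : EuclideanSpace ℝ (Fin n) × EuclideanSpace ℝ (Fin n) =>
      ‖z.2‖ • z.1 := by fun_prop
  have hm2 : Measurable fun z : EuclideanSpace ℝ (Fin n) × EuclideanSpace ℝ (Fin n) =>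
      ‖z.1‖ • z.2 := by fun_prop
  calc ν D = (ν.prod ν') (Prod.fst ⁻¹' D) :=
        (measurePreserving_fst.measure_preimage hD.nullMeasurableSet).symm
    -- Positive scaling does not leave the cone. `W ≠ 0` is used here; `V = 0` is harmless below
    -- because `0 ∉ D`.
    _ ≤ (ν.prod ν') ((fun z => ‖z.2‖ • z.1) ⁻¹' D) := by
        refine measure_mono_ae ?_
        filter_upwards [Measure.quasiMeasurePreserving_snd.ae hν'] with z hz hzD
        exact (hsmul _ (norm_pos_iff.2 hz) _).2 hzD
    _ = (ν.prod ν') ((fun z => ‖z.1‖ • z.2) ⁻¹' D) := by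
        rw [← Measure.map_apply hm1 hD, ← Measure.map_apply hm2 hD, h.map_prod_eq h']
    _ ≤ (ν.prod ν') (Prod.snd ⁻¹' D) := by
        refine measure_mono fun z hz => ?_
        rcases eq_or_ne z.1 0 with h1 | h1
        · simp [h1] at hz
          exact absurd hz h0
        · exact (hsmul _ (norm_pos_iff.2 h1) _).1 hz
    _ = ν' D := measurePreserving_snd.measure_preimage hD.nullMeasurableSet

lemma isRadial_stdGaussian (i : Fin n) :
    IsRadial i ((stdGaussian (EuclideanSpace ℝ (Fin n))).map (zeroCoord i)) where
  charFun_eq θ θ' hθ h h' := by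
    have key : ∀ θ : EuclideanSpace ℝ (Fin n), θ i = 0 →
        charFun ((stdGaussian (EuclideanSpace ℝ (Fin n))).map (zeroCoord i)) θ =
          Complex.exp (-‖θ‖ ^ 2 / 2) := fun θ hθ => by
      rw [charFun_apply, integral_map (by fun_prop) (by fun_prop)]
      simp only [inner_zeroCoord, zeroCoord_eq_self hθ]
      rw [← charFun_apply, charFun_stdGaussian]
    rw [key θ h, key θ' h', hθ]
  ae_eq_zero := by
    rw [ae_map_iff (by fun_prop) (measurableSet_eq_fun (by fun_prop) measurable_const)]
    exact ae_of_all _ fun v => zeroCoord_self i v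

/-- The off-diagonal part of the `i`-th row of the hat matrix. -/
noncomputable def hatRow (i : Fin n) (X : Fin n → EuclideanSpace ℝ (Fin p)) :
    EuclideanSpace ℝ (Fin n) := zeroCoord i (WithLp.toLp 2 (hatMatrix X i))

@[fun_prop]
lemma measurable_hatRow (i : Fin n) : Measurable (hatRow (p := p) i) := by
  refine (continuous_zeroCoord i).measurable.comp ((WithLp.measurable_toLp 2 _).comp ?_)
  exact measurable_pi_lambda _ fun j => measurable_hatMatrix i j

lemma isRadial_hatRow (i : Fin n) : IsRadial i ((gaussSample n p).map (hatRow i)) where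
  charFun_eq θ θ' hθ h h' := by
    have hdot : ∀ θ : EuclideanSpace ℝ (Fin n), θ.ofLp ⬝ᵥ θ.ofLp = ‖θ‖ ^ 2 := fun θ => by
      rw [EuclideanSpace.real_norm_sq_eq]
      simp [dotProduct, sq]
    obtain ⟨O, hOt, hOO, hOθ, hfix⟩ := exists_reflection (a := θ.ofLp) (b := θ'.ofLp)
      (by rw [hdot, hdot, hθ])
    have hO : Oᵀ * O = 1 := by rw [hOt, hOO]
    -- As both frequencies vanish at `i`, the reflection exchanging them fixes the `i`-th basis
    -- vector, so mixing by it acts on the `i`-th row alone.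
    have hOi : O *ᵥ Pi.single i 1 = Pi.single i 1 :=
      hfix _ (by simpa using h) (by simpa using h')
    have hinner : ∀ X : Fin n → EuclideanSpace ℝ (Fin p), ∀ θ : EuclideanSpace ℝ (Fin n),
        θ i = 0 → inner ℝ (hatRow i X) θ = hatMatrix X i ⬝ᵥ θ.ofLp := fun X θ hθ => by
      rw [hatRow, inner_zeroCoord, zeroCoord_eq_self hθ]
      simp [PiLp.inner_apply, dotProduct, mul_comm]
    have hrow : ∀ X : Fin n → EuclideanSpace ℝ (Fin p),
        hatMatrix (mix O X) i ⬝ᵥ θ.ofLp = hatMatrix X i ⬝ᵥ θ'.ofLp := fun X => by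
      have h1 : ∀ (M : Matrix (Fin n) (Fin n) ℝ) (v : Fin n → ℝ),
          M i ⬝ᵥ v = Pi.single i 1 ⬝ᵥ (M *ᵥ v) := fun M v => by
        simp [Matrix.mulVec]
      rw [h1, h1, hatMatrix_mix hO, hOt, ← Matrix.mulVec_mulVec, hOθ, ← Matrix.mulVec_mulVec,
        Matrix.dotProduct_mulVec _ O, ← Matrix.mulVec_transpose, hOt, hOi]
    rw [charFun_apply, charFun_apply, integral_map (by fun_prop) (by fun_prop),
      integral_map (by fun_prop) (by fun_prop)]
    have hmeas : Measurable fun X : Fin n → EuclideanSpace ℝ (Fin p) =>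
        Complex.exp (inner ℝ (hatRow i X) θ * Complex.I) := by fun_prop
    conv_lhs => rw [← (measurePreserving_mix (p := p) hO).map_eq]
    rw [integral_map (by fun_prop) hmeas.aestronglyMeasurable]
    refine integral_congr_ae (ae_of_all _ fun X => ?_)
    simp only [hinner _ _ h, hinner _ _ h', hrow]
  ae_eq_zero := by
    rw [ae_map_iff (by fun_prop) (measurableSet_eq_fun (by fun_prop) measurable_const)]
    exact ae_of_all _ fun v => zeroCoord_self i _

lemma stdGaussian_smallBall {i : Fin n} {J : Finset (Fin n)} (hi : i ∉ J) (hJ : n ≤ 4 * J.card) :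
    stdGaussian (EuclideanSpace ℝ (Fin n))
      {g | ∑ j ∈ J, zeroCoord i g j ^ 2 < (1 / 2 ^ 33) * ‖zeroCoord i g‖ ^ 2} ≤
      ENNReal.ofReal ((1 / 8) ^ n) := by
  -- The ratio of `2^31` to `1/4` is the constant `2^33`. Each index costs a factor at most 2 and
  -- each index of `J` gains `2^(-16)`; with `4|J| ≥ n` this gives `8^(-n)`, small enough to survive
  -- a union over all `2^n` sets `J`.
  set a : Fin n → ℝ := fun j => if j ∈ J then 1 / 4 - 2 ^ 31 else 1 / 4 with ha
  have hlt : ∀ j, a j < 1 / 2 := fun j => by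
    simp only [ha]; split_ifs <;> norm_num
  have h := stdGaussian_chernoff (EuclideanSpace.basisFun (Fin n) ℝ) hlt
  have hprod : ∏ j, (√(1 - 2 * a j))⁻¹ ≤ (1 / 8) ^ n := by
    calc ∏ j, (√(1 - 2 * a j))⁻¹ ≤ ∏ j, (2 * if j ∈ J then (1 / 2 ^ 16 : ℝ) else 1) := by
          refine Finset.prod_le_prod (fun j _ => by positivity) fun j _ => ?_
          simp only [ha]
          split_ifs
          · refine inv_le_of_inv_le₀ (by positivity) (Real.le_sqrt_of_sq_le ?_)
            norm_num
          · refine inv_le_of_inv_le₀ (by positivity) (Real.le_sqrt_of_sq_le ?_)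
            norm_num
      _ = 2 ^ n * (1 / 2 ^ 16) ^ J.card := by
          rw [Finset.prod_mul_distrib, Finset.prod_ite_mem, Finset.univ_inter]
          simp
      _ = 2 ^ n * (1 / 2 ^ 4) ^ (4 * J.card) := by
          rw [pow_mul (1 / 2 ^ 4 : ℝ)]; norm_num
      _ ≤ 2 ^ n * (1 / 2 ^ 4) ^ n :=
          mul_le_mul_of_nonneg_left (pow_le_pow_of_le_one (by norm_num) (by norm_num) hJ)
            (by positivity)
      _ = (1 / 8) ^ n := by rw [← mul_pow]; norm_num
  refine (measure_mono fun g hg => ?_).trans (h.trans (ENNReal.ofReal_le_ofReal hprod))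
  simp only [mem_ofPred_eq, EuclideanSpace.basisFun_inner] at hg ⊢
  have h1 : ∑ j ∈ J, zeroCoord i g j ^ 2 = ∑ j ∈ J, g j ^ 2 :=
    Finset.sum_congr rfl fun j hj => by
      rw [zeroCoord_of_ne (ne_of_mem_of_not_mem hj hi)]
  have h2 : ‖zeroCoord i g‖ ^ 2 ≤ ∑ j, g j ^ 2 := by
    rw [norm_sq_zeroCoord]
    exact Finset.sum_le_sum_of_subset_of_nonneg (Finset.erase_subset _ _) fun _ _ _ => sq_nonneg _
  have h3 : ∑ j, a j * g j ^ 2 = 1 / 4 * ∑ j, g j ^ 2 - 2 ^ 31 * ∑ j ∈ J, g j ^ 2 := by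
    have h4 : ∀ j, a j * g j ^ 2 = 1 / 4 * g j ^ 2 - if j ∈ J then 2 ^ 31 * g j ^ 2 else 0 := by
      intro j
      simp only [ha]
      split_ifs <;> ring
    simp only [h4]
    rw [Finset.sum_sub_distrib, Finset.sum_ite_mem, Finset.univ_inter, ← Finset.mul_sum,
      ← Finset.mul_sum]
  rw [h3]
  rw [h1] at hg
  linarith

lemma gaussSample_hatRow_smallBall {i : Fin n} {J : Finset (Fin n)} (hi : i ∉ J)
    (hJ : n ≤ 4 * J.card) :
    gaussSample n p {X | ∑ j ∈ J, hatRow i X j ^ 2 < (1 / 2 ^ 33) * ‖hatRow i X‖ ^ 2} ≤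
      ENNReal.ofReal ((1 / 8) ^ n) := by
  set D : Set (EuclideanSpace ℝ (Fin n)) :=
    {v | ∑ j ∈ J, v j ^ 2 < (1 / 2 ^ 33) * ‖v‖ ^ 2} with hD
  have hDmeas : MeasurableSet D := measurableSet_lt (by fun_prop) (by fun_prop)
  obtain ⟨j, hj⟩ : J.Nonempty := by
    rw [← Finset.card_pos]
    have := i.pos
    omega
  have hji : j ≠ i := ne_of_mem_of_not_mem hj hi
  have : IsProbabilityMeasure ((gaussSample n p).map (hatRow i)) :=
    Measure.isProbabilityMeasure_map (by fun_prop)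
  have : IsProbabilityMeasure ((stdGaussian (EuclideanSpace ℝ (Fin n))).map (zeroCoord i)) :=
    Measure.isProbabilityMeasure_map (by fun_prop)
  have hne : ∀ᵐ w ∂((stdGaussian (EuclideanSpace ℝ (Fin n))).map (zeroCoord i)), w ≠ 0 := by
    refine (ae_map_iff (by fun_prop) (measurableSet_singleton 0).compl).2 ?_
    have hmp := measurePreserving_inner_stdGaussian
      (v := EuclideanSpace.single j (1 : ℝ)) (by simp)
    have := nullSingletonClass_gaussianReal (μ := 0) (v := 1) one_ne_zero
    filter_upwards [hmp.quasiMeasurePreserving.ae (Measure.ae_ne _ 0)] with g hg h0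
    refine hg ?_
    have h1 : zeroCoord i g j = 0 := by rw [h0]; rfl
    rw [zeroCoord_of_ne hji] at h1
    rw [EuclideanSpace.inner_single_right]
    simpa using h1
  have h := (isRadial_hatRow (p := p) i).measure_cone_le (isRadial_stdGaussian i) hne hDmeas
    (fun c hc v => by
      simp only [hD, mem_ofPred_eq, PiLp.smul_apply, smul_eq_mul, mul_pow, norm_smul,
        ← Finset.mul_sum, Real.norm_eq_abs, sq_abs]
      rw [mul_left_comm]
      exact mul_lt_mul_iff_right₀ (by positivity))
    (by simp [hD])
  rw [Measure.map_apply (by fun_prop) hDmeas, Measure.map_apply (by fun_prop) hDmeas] at h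
  exact h.trans (stdGaussian_smallBall hi hJ)

/-- With overwhelming probability the rows of the hat matrix are spread out. -/
lemma gaussSample_spread (n p : ℕ) :
    gaussSample n p {X | ¬ ∀ (i : Fin n) (J : Finset (Fin n)), i ∉ J → n ≤ 4 * J.card →
      (1 / 2 ^ 33) * ‖hatRow i X‖ ^ 2 ≤ ∑ j ∈ J, hatRow i X j ^ 2} ≤
      ENNReal.ofReal (n * (1 / 4) ^ n) := by
  calc _ ≤ gaussSample n p (⋃ i : Fin n, ⋃ J : Finset (Fin n),
        {X | (i ∉ J ∧ n ≤ 4 * J.card) ∧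
          ∑ j ∈ J, hatRow i X j ^ 2 < (1 / 2 ^ 33) * ‖hatRow i X‖ ^ 2}) := by
        refine measure_mono fun X hX => ?_
        simp only [mem_ofPred_eq, not_forall, not_le] at hX
        obtain ⟨i, J, h1, h2, h3⟩ := hX
        exact mem_iUnion.2 ⟨i, mem_iUnion.2 ⟨J, ⟨h1, h2⟩, h3⟩⟩
    _ ≤ ∑ _i : Fin n, ∑ _J : Finset (Fin n), ENNReal.ofReal ((1 / 8) ^ n) := by
        refine (measure_iUnion_fintype_le _ _).trans (Finset.sum_le_sum fun i _ => ?_)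
        refine (measure_iUnion_fintype_le _ _).trans (Finset.sum_le_sum fun J _ => ?_)
        by_cases h : i ∉ J ∧ n ≤ 4 * J.card
        · exact (measure_mono fun X hX => hX.2).trans (gaussSample_hatRow_smallBall h.1 h.2)
        · simp [h]
    _ = ENNReal.ofReal (n * (1 / 4) ^ n) := by
        rw [Finset.sum_const, Finset.sum_const, Finset.card_univ, Finset.card_univ,
          Fintype.card_finset, Fintype.card_fin, ← ENNReal.ofReal_nsmul, ← ENNReal.ofReal_nsmul,
          nsmul_eq_mul, nsmul_eq_mul, Nat.cast_pow, ← mul_pow]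
        norm_num

end Spherical

/-! ### The norm of the sample covariance matrix. -/

section OperatorNorm

variable {n p : ℕ}

/-- After normalisation `‖v‖ < 2` turns the threshold `64 n` into `16 n`; the exponential moment at
`1/4` then gives `e^(-4n)` times at most `2^n`. -/
lemma gaussSample_direction {v : EuclideanSpace ℝ (Fin p)} (hn : 0 < n) (hv : ‖v‖ < 2) :
    gaussSample n p {X | 64 * (n : ℝ) ≤ ∑ i, (inner ℝ (X i) v) ^ 2} ≤
      ENNReal.ofReal (2 ^ n * Real.exp (-(4 * n))) := by
  have hn' : (0 : ℝ) < n := by exact_mod_cast hn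
  rcases eq_or_ne v 0 with rfl | hv0
  · have : {X : Fin n → EuclideanSpace ℝ (Fin p) | 64 * (n : ℝ) ≤
        ∑ i, (inner ℝ (X i) (0 : EuclideanSpace ℝ (Fin p))) ^ 2} = ∅ := by
      ext X
      simp [hn]
    rw [this]
    simp
  have hvn : 0 < ‖v‖ := norm_pos_iff.2 hv0
  have hunit : ‖(‖v‖⁻¹ : ℝ) • v‖ = 1 := by
    rw [norm_smul, norm_inv, norm_norm, inv_mul_cancel₀ hvn.ne']
  have h := pi_chernoff (fun _ : Fin n => stdGaussian (EuclideanSpace ℝ (Fin p)))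
    (fun _ => measurePreserving_inner_stdGaussian hunit) (a := fun _ => 1 / 4)
    (fun _ => by norm_num) (4 * n)
  refine (measure_mono fun X hX => ?_).trans (h.trans (ENNReal.ofReal_le_ofReal ?_))
  · simp only [mem_ofPred_eq, inner_smul_right, mul_pow] at hX ⊢
    have h1 : 1 / 4 ≤ (‖v‖⁻¹) ^ 2 := by
      rw [inv_pow, le_inv_comm₀ (by norm_num) (by positivity)]
      nlinarith
    have h2 : ∀ i, 1 / 16 * (inner ℝ (X i) v) ^ 2 ≤
        1 / 4 * ((‖v‖⁻¹) ^ 2 * (inner ℝ (X i) v) ^ 2) := fun i => by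
      nlinarith [mul_le_mul_of_nonneg_right h1 (sq_nonneg (inner ℝ (X i) v : ℝ))]
    have h3 := Finset.sum_le_sum fun i (_ : i ∈ Finset.univ) => h2 i
    rw [← Finset.mul_sum] at h3
    linarith
  · rw [Finset.prod_const, Finset.card_univ, Fintype.card_fin, mul_comm]
    refine mul_le_mul_of_nonneg_right (pow_le_pow_left₀ (by positivity) ?_ _) (Real.exp_pos _).le
    refine inv_le_of_inv_le₀ (by positivity) (Real.le_sqrt_of_sq_le ?_)
    norm_num

/-- The norm of the scatter matrix of a Gaussian sample is of order `n`, with overwhelming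
probability. -/
lemma gaussSample_scatter_bound (hn : 0 < n) (hpn : p ≤ n) :
    gaussSample n p {X | ¬ ∀ v : EuclideanSpace ℝ (Fin p),
      ∑ i, (inner ℝ (X i) v) ^ 2 ≤ 64 * n * ‖v‖ ^ 2} ≤ ENNReal.ofReal (Real.exp (-n)) := by
  set γ := gaussSample n p
  set E := EuclideanSpace ℝ (Fin p)
  set c := ENNReal.ofReal (2 ^ n * Real.exp (-(4 * n)))
  set S : Set ((Fin n → E) × E) :=
    {z | ‖z.2‖ < 2 ∧ 64 * (n : ℝ) ≤ ∑ i, (inner ℝ (z.1 i) z.2) ^ 2} with hS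
  have hSmeas : MeasurableSet S := by
    have h1 : MeasurableSet {z : (Fin n → E) × E | ‖z.2‖ < 2} :=
      measurableSet_lt (by fun_prop) measurable_const
    have h2 : MeasurableSet
        {z : (Fin n → E) × E | 64 * (n : ℝ) ≤ ∑ i, (inner ℝ (z.1 i) z.2) ^ 2} := by
      refine measurableSet_le measurable_const (Continuous.measurable ?_)
      fun_prop
    exact h1.inter h2
  -- Lebesgue volume replaces an ε-net. `F` is the volume of the bad vectors in the ball of radius
  -- 2; its mean is small by Fubini, but one bad unit vector forces it to be at least half the
  -- volume of a unit ball.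
  set F : (Fin n → E) → ENNReal := fun X => volume (Prod.mk X ⁻¹' S) with hF
  have hFmeas : Measurable F := measurable_measure_prodMk_left hSmeas
  have hb0 : volume (Metric.ball (0 : E) 1) ≠ 0 :=
    (Metric.measure_ball_pos volume 0 one_pos).ne'
  have hbt : volume (Metric.ball (0 : E) 1) ≠ ⊤ := measure_ball_lt_top.ne
  have hint : ∫⁻ X, F X ∂γ ≤ c * (ENNReal.ofReal (2 ^ p) * volume (Metric.ball (0 : E) 1)) := by
    calc ∫⁻ X, F X ∂γ = (γ.prod volume) S := (Measure.prod_apply hSmeas).symm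
      _ = ∫⁻ v, γ ((fun X => (X, v)) ⁻¹' S) := Measure.prod_apply_symm hSmeas
      _ ≤ ∫⁻ v, (Metric.ball (0 : E) 2).indicator (fun _ => c) v := by
          refine lintegral_mono fun v => ?_
          by_cases hv : ‖v‖ < 2
          · rw [indicator_of_mem (by simpa using hv)]
            exact (measure_mono fun X hX => hX.2).trans (gaussSample_direction hn hv)
          · have : (fun X : Fin n → E => (X, v)) ⁻¹' S = ∅ := by
              ext X
              simp only [hS, mem_preimage, mem_ofPred_eq, hv, false_and, mem_empty_iff_false]
            rw [this]
            simp
      _ = c * volume (Metric.ball (0 : E) 2) := by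
          rw [lintegral_indicator measurableSet_ball, setLIntegral_const]
      _ = _ := by
          rw [Measure.addHaar_ball_of_pos volume 0 two_pos, finrank_euclideanSpace,
            Fintype.card_fin]
  have hbad : {X : Fin n → E | ¬ ∀ v : E, ∑ i, (inner ℝ (X i) v) ^ 2 ≤ 64 * n * ‖v‖ ^ 2} ⊆
      {X | volume (Metric.ball (0 : E) 1) ≤ 2 * F X} := by
    intro X hX
    simp only [mem_ofPred_eq, not_forall, not_le] at hX ⊢
    obtain ⟨v, hv⟩ := hX
    have hv0 : v ≠ 0 := by
      rintro rfl
      simp at hv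
    have hvn : 0 < ‖v‖ := norm_pos_iff.2 hv0
    set e := (‖v‖⁻¹ : ℝ) • v with he
    have hunit : ‖e‖ = 1 := by
      rw [he, norm_smul, norm_inv, norm_norm, inv_mul_cancel₀ hvn.ne']
    have hQe : 64 * (n : ℝ) ≤ ∑ i, (inner ℝ (X i) e) ^ 2 := by
      simp only [he, inner_smul_right, mul_pow]
      rw [← Finset.mul_sum, inv_pow, ← div_eq_inv_mul, le_div_iff₀ (by positivity)]
      exact hv.le
    set A := Prod.mk X ⁻¹' S with hA
    have hAmeas : MeasurableSet A := measurable_prodMk_left hSmeas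
    -- By convexity of the quadratic form, of two points symmetric about the bad vector `e` at least
    -- one is bad.
    have hcover : Metric.ball e 1 ⊆ A ∪ (fun w => (e + e) - w) ⁻¹' A := by
      intro w hw
      rw [mem_ball_iff_norm] at hw
      have hw1 : ‖w‖ < 2 := by
        have := norm_add_le (w - e) e
        rw [sub_add_cancel] at this
        linarith
      have hw2 : ‖(e + e) - w‖ < 2 := by
        have := norm_sub_le e (w - e)
        rw [show e - (w - e) = (e + e) - w by abel] at this
        linarith
      by_cases h1 : 64 * (n : ℝ) ≤ ∑ i, (inner ℝ (X i) w) ^ 2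
      · exact Or.inl ⟨hw1, h1⟩
      · refine Or.inr ⟨hw2, ?_⟩
        have h2 : 2 * ∑ i, (inner ℝ (X i) e) ^ 2 ≤
            ∑ i, (inner ℝ (X i) w) ^ 2 + ∑ i, (inner ℝ (X i) ((e + e) - w)) ^ 2 := by
          rw [Finset.mul_sum, ← Finset.sum_add_distrib]
          refine Finset.sum_le_sum fun i _ => ?_
          rw [inner_sub_right, inner_add_right]
          nlinarith [sq_nonneg ((inner ℝ (X i) w : ℝ) - inner ℝ (X i) e)]
        push Not at h1
        change 64 * (n : ℝ) ≤ ∑ i, (inner ℝ (X i) ((e + e) - w)) ^ 2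
        linarith
    calc volume (Metric.ball (0 : E) 1) = volume (Metric.ball e 1) :=
          (Measure.addHaar_ball_center volume e 1).symm
      _ ≤ volume A + volume ((fun w => (e + e) - w) ⁻¹' A) :=
          (measure_mono hcover).trans (measure_union_le _ _)
      _ = 2 * F X := by
          rw [(Measure.measurePreserving_sub_left volume (e + e)).measure_preimage
            hAmeas.nullMeasurableSet, two_mul]
  have hmarkov := mul_meas_ge_le_lintegral (μ := γ) (hFmeas.const_mul 2)
    (volume (Metric.ball (0 : E) 1))
  rw [lintegral_const_mul _ hFmeas] at hmarkov
  have h1 : volume (Metric.ball (0 : E) 1) *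
      γ {X | volume (Metric.ball (0 : E) 1) ≤ 2 * F X} ≤
      volume (Metric.ball (0 : E) 1) * (2 * (c * ENNReal.ofReal (2 ^ p))) := by
    refine hmarkov.trans ((mul_le_mul_right hint 2).trans (le_of_eq ?_))
    ring
  have h2 := (ENNReal.mul_le_mul_iff_right hb0 hbt).1 h1
  refine (measure_mono hbad).trans (h2.trans ?_)
  rw [← ENNReal.ofReal_mul (by positivity), show (2 : ENNReal) = ENNReal.ofReal 2 by simp,
    ← ENNReal.ofReal_mul (by positivity)]
  refine ENNReal.ofReal_le_ofReal ?_
  have h3 : (2 : ℝ) ^ p ≤ 2 ^ n := pow_le_pow_right₀ (by norm_num) hpn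
  have h4 : (2 : ℝ) ≤ 2 ^ n := by
    calc (2 : ℝ) = 2 ^ 1 := by norm_num
      _ ≤ 2 ^ n := pow_le_pow_right₀ (by norm_num) hn
  have h5 : (2 : ℝ) ≤ Real.exp 1 := by linarith [Real.add_one_le_exp (1 : ℝ)]
  calc 2 * (2 ^ n * Real.exp (-(4 * n)) * 2 ^ p)
      ≤ 2 ^ n * (2 ^ n * Real.exp (-(4 * n)) * 2 ^ n) := by gcongr
    _ ≤ Real.exp 1 ^ n * (Real.exp 1 ^ n * Real.exp (-(4 * n)) * Real.exp 1 ^ n) := by gcongr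
    _ = Real.exp (-n) := by
        rw [← Real.exp_nat_mul, mul_one, ← Real.exp_add, ← Real.exp_add, ← Real.exp_add]
        congr 1
        ring

end OperatorNorm

/-! ### Union bound and Borel–Cantelli. -/

section Rate

variable {n p : ℕ} {u : ℝ → ℝ} {y : ℝ}

/-- The event that Maronna's estimator exists, is unique, and is within `ε` of the sample
covariance after scaling. -/
def MaronnaClose (u : ℝ → ℝ) (y ε : ℝ) (X : Fin n → EuclideanSpace ℝ (Fin p)) : Prop :=
  (∃! S, IsMaronnaSolution u X S) ∧ maronnaError u y X ≤ ε

/-- As `H` is idempotent, the off-diagonal part of row `i` has squared norm `h_ii (1 - h_ii)`. -/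
lemma hatSpread_of_hatRow {X : Fin n → EuclideanSpace ℝ (Fin p)}
    (hA : (scatter (dataRows X) 1).PosDef) {τ b : ℝ} (hτ : 0 ≤ τ)
    (hb : ∀ i, b ≤ hatMatrix X i i * (1 - hatMatrix X i i))
    (h : ∀ (i : Fin n) (J : Finset (Fin n)), i ∉ J → n ≤ 4 * J.card →
      τ * ‖hatRow i X‖ ^ 2 ≤ ∑ j ∈ J, hatRow i X j ^ 2) :
    HatSpread (dataRows X) (τ * b) := by
  intro i J hi hJ
  have h1 : ‖hatRow i X‖ ^ 2 = hatMatrix X i i * (1 - hatMatrix X i i) := by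
    rw [hatRow, norm_sq_zeroCoord]
    have h2 := sum_hat_sq hA i
    rw [← Finset.add_sum_erase _ _ (Finset.mem_univ i)] at h2
    simp only [hatMatrix, Matrix.of_apply]
    linarith
  have h3 : ∑ j ∈ J, hatRow i X j ^ 2 = ∑ j ∈ J, hat (dataRows X) i j ^ 2 :=
    Finset.sum_congr rfl fun j hj => by
      rw [hatRow, zeroCoord_of_ne (ne_of_mem_of_not_mem hj hi)]
      rfl
  rw [← h3]
  refine le_trans ?_ (h i J hi hJ)
  rw [h1]
  exact mul_le_mul_of_nonneg_left (hb i) hτ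

lemma exists_gaussSample_rate (hy0 : 0 < y) (hy1 : y < 1) (hA1 : AssumptionA1 u y)
    (hA2 : AssumptionA2 u) :
    ∃ C c c' : ℝ, 0 < C ∧ 0 < c ∧ 0 < c' ∧ ∀ ε : ℝ, 0 < ε → ε < c' →
      ∃ δ : ℝ, 0 < δ ∧ ∀ n p : ℕ, 0 < n → |(p : ℝ) / (n : ℝ) - y| ≤ δ →
        gaussSample n p {X | ¬ MaronnaClose u y ε X} ≤
          ENNReal.ofReal (C * (n : ℝ) * Real.exp (-c * ε ^ 2 * (n : ℝ))) := by
  set b : ℝ := y / 2 * ((1 - y) / 2) with hb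
  have hy1' : 0 < 1 - y := by linarith
  have hbpos : 0 < b := by positivity
  obtain ⟨K, c₁, hK, hc₁, H⟩ := exists_weightsWithin hy0 hA1 hA2
    (α := 1 / 2 ^ 33 * b) (by positivity)
  set m : ℝ := min (y / 4) ((1 - y) / 4) with hm
  have hmpos : 0 < m := lt_min (by linarith) (by linarith)
  have hm1 : m ≤ y / 4 := min_le_left _ _
  have hm2 : m ≤ (1 - y) / 4 := min_le_right _ _
  -- The leverage tolerance `η = ε / (64 K)` makes the error `K η · 64 = ε`, and `c ε² ≤ η² / 64`
  -- matches the leverage bound. The union bound needs only `C = 4`; since `32 > 27 > e³`, the claim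
  -- is trivial for `n < 4`.
  refine ⟨32, min 1 (1 / (64 * (64 * K) ^ 2)), min 1 (64 * K * min c₁ m), by norm_num,
    by positivity, by positivity, fun ε hε hεc => ?_⟩
  set c := min 1 (1 / (64 * (64 * K) ^ 2)) with hc
  have hc0 : 0 < c := by positivity
  have hε1 : ε < 1 := hεc.trans_le (min_le_left _ _)
  set η := ε / (64 * K) with hη
  have hηpos : 0 < η := by positivity
  have hηc : η < min c₁ m := by
    rw [hη, div_lt_iff₀' (by positivity)]
    exact hεc.trans_le (min_le_right _ _)
  have hηm : η < m := hηc.trans_le (min_le_right _ _)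
  obtain ⟨δ, hδ, Hδ⟩ := H η hηpos (hηc.trans_le (min_le_left _ _))
  refine ⟨min δ m, lt_min hδ hmpos, fun n p hn hp => ?_⟩
  have hn1 : (1 : ℝ) ≤ n := by exact_mod_cast hn
  have hpm := abs_le.1 (hp.trans (min_le_right _ _))
  have hpn : p ≤ n := by
    have h1 : (p : ℝ) / n ≤ 1 := by linarith [hpm.2]
    rw [div_le_one (by linarith)] at h1
    exact_mod_cast h1
  have hcε : c * ε ^ 2 ≤ 1 := by
    have h1 : c ≤ 1 := min_le_left _ _
    have h2 : ε ^ 2 ≤ 1 := pow_le_one₀ hε.le hε1.le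
    exact mul_le_one₀ h1 (by positivity) h2
  have hcη : c * ε ^ 2 ≤ η ^ 2 / 64 := by
    have h1 : c ≤ 1 / (64 * (64 * K) ^ 2) := min_le_right _ _
    calc c * ε ^ 2 ≤ 1 / (64 * (64 * K) ^ 2) * ε ^ 2 :=
          mul_le_mul_of_nonneg_right h1 (by positivity)
      _ = η ^ 2 / 64 := by rw [hη]; field_simp
  have he : Real.exp 1 < 3 := Real.exp_one_lt_d9.trans (by norm_num)
  have hexpn : Real.exp (-(n : ℝ)) ≤ Real.exp (-c * ε ^ 2 * n) := by
    rw [Real.exp_le_exp]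
    have := mul_le_mul_of_nonneg_right hcε (by linarith : (0 : ℝ) ≤ n)
    linarith
  rcases lt_or_ge n 4 with hn4 | hn4
  · refine prob_le_one.trans ?_
    rw [ENNReal.one_le_ofReal]
    have h3 : (n : ℝ) ≤ 3 := by exact_mod_cast (by omega : n ≤ 3)
    have h4 : 1 / 27 ≤ Real.exp (-(n : ℝ)) := by
      calc (1 / 27 : ℝ) ≤ (Real.exp 1 ^ 3)⁻¹ := by
            rw [one_div]
            refine inv_anti₀ (by positivity) ?_
            calc Real.exp 1 ^ 3 ≤ 3 ^ 3 := pow_le_pow_left₀ (Real.exp_pos _).le he.le _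
              _ = 27 := by norm_num
        _ = Real.exp (-3) := by
            rw [← Real.exp_nat_mul, ← Real.exp_neg]; norm_num
        _ ≤ Real.exp (-n) := Real.exp_le_exp.2 (by linarith)
    have h5 := h4.trans hexpn
    nlinarith
  have hsub : {X : Fin n → EuclideanSpace ℝ (Fin p) | ¬ MaronnaClose u y ε X} ⊆
      {X | ¬ (scatter (dataRows X) 1).PosDef} ∪
      ((⋃ i : Fin n, {X | η ≤ |hatMatrix X i i - (p : ℝ) / n|}) ∪
      ({X | ¬ ∀ (i : Fin n) (J : Finset (Fin n)), i ∉ J → n ≤ 4 * J.card →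
        (1 / 2 ^ 33) * ‖hatRow i X‖ ^ 2 ≤ ∑ j ∈ J, hatRow i X j ^ 2} ∪
      {X | ¬ ∀ v : EuclideanSpace ℝ (Fin p),
        ∑ i, (inner ℝ (X i) v) ^ 2 ≤ 64 * n * ‖v‖ ^ 2})) := by
    intro X hX
    by_contra hcon
    simp only [mem_union, mem_iUnion, mem_ofPred_eq, not_or, not_exists, not_not, not_le] at hcon
    obtain ⟨hA, hlev, hspread, hnorm⟩ := hcon
    refine hX ?_
    have hb' : ∀ i, b ≤ hatMatrix X i i * (1 - hatMatrix X i i) := fun i => by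
      have h1 := abs_lt.1 (hlev i)
      have h2 : y / 2 ≤ hatMatrix X i i := by linarith
      have h3 : (1 - y) / 2 ≤ 1 - hatMatrix X i i := by linarith
      exact mul_le_mul h2 h3 (by positivity) (by linarith)
    obtain ⟨huniq, w, hw, hwK⟩ := Hδ n p hn4 (hp.trans (min_le_left _ _)) X hA
      (fun i => (hlev i).le) (hatSpread_of_hatRow hA (by positivity) hb' hspread)
    refine ⟨huniq, ?_⟩
    have herr := maronnaError_le hn hy0 hA1 hA2 hw (T := 64) (by positivity) (by norm_num) hwK
      (fun v => by
        have h1 := hnorm (WithLp.toLp 2 v)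
        have h2 : ‖(WithLp.toLp 2 v : EuclideanSpace ℝ (Fin p))‖ ^ 2 = v ⬝ᵥ v := by
          rw [EuclideanSpace.real_norm_sq_eq]; simp [dotProduct, sq]
        have h3 : ∀ i, inner ℝ (X i) (WithLp.toLp 2 v) = (X i).ofLp ⬝ᵥ v := fun i => by
          simp [PiLp.inner_apply, dotProduct, mul_comm]
        simpa only [h2, h3] using h1)
    refine herr.trans (le_of_eq ?_)
    rw [hη]
    field_simp
  have hP0 : gaussSample n p {X | ¬ (scatter (dataRows X) 1).PosDef} = 0 :=
    ae_iff.1 (ae_posDef_scatter hpn)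
  have hP1 : gaussSample n p (⋃ i : Fin n, {X | η ≤ |hatMatrix X i i - (p : ℝ) / n|}) ≤
      ENNReal.ofReal (n * (2 * Real.exp (-(η ^ 2 * n / 64)))) := by
    refine (measure_iUnion_fintype_le _ _).trans ((Finset.sum_le_sum fun i _ =>
      gaussSample_leverage hpn hηpos (by linarith) i).trans (le_of_eq ?_))
    rw [Finset.sum_const, Finset.card_univ, Fintype.card_fin, ← ENNReal.ofReal_nsmul, nsmul_eq_mul]
  refine (measure_mono hsub).trans ((measure_union_le _ _).trans ?_)
  rw [hP0, zero_add]
  refine (measure_union_le _ _).trans ((add_le_add hP1 ((measure_union_le _ _).trans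
    (add_le_add (gaussSample_spread n p) (gaussSample_scatter_bound hn hpn)))).trans ?_)
  rw [← ENNReal.ofReal_add (by positivity) (by positivity),
    ← ENNReal.ofReal_add (by positivity) (by positivity)]
  refine ENNReal.ofReal_le_ofReal ?_
  have h1 : Real.exp (-(η ^ 2 * n / 64)) ≤ Real.exp (-c * ε ^ 2 * n) := by
    rw [Real.exp_le_exp]
    have := mul_le_mul_of_nonneg_right hcη (by linarith : (0 : ℝ) ≤ n)
    linarith
  have h2 : (1 / 4 : ℝ) ^ n ≤ Real.exp (-c * ε ^ 2 * n) := by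
    refine le_trans ?_ hexpn
    rw [show -(n : ℝ) = n * (-1) by ring, Real.exp_nat_mul, Real.exp_neg]
    refine pow_le_pow_left₀ (by norm_num) ?_ _
    rw [one_div]
    exact inv_anti₀ (Real.exp_pos _) (by linarith)
  set e := Real.exp (-c * ε ^ 2 * n)
  have he0 : 0 < e := Real.exp_pos _
  have h3 : (n : ℝ) * (2 * Real.exp (-(η ^ 2 * n / 64))) ≤ n * (2 * e) := by gcongr
  have h4 : (n : ℝ) * (1 / 4) ^ n ≤ n * e := by gcongr
  have h5 : Real.exp (-(n : ℝ)) ≤ n * e := hexpn.trans (le_mul_of_one_le_left he0.le hn1)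
  have h6 : 0 < n * e := by positivity
  linarith

/-- Stated for arbitrary sets, as the events involving the chosen solution are not shown to be
measurable; outer measure suffices. -/
lemma IsGaussianSample.measure_le {Ω : Type*} [MeasurableSpace Ω] {μ : Measure Ω}
    [IsProbabilityMeasure μ] {X : Fin n → Ω → EuclideanSpace ℝ (Fin p)}
    (h : IsGaussianSample μ X) (s : Set (Fin n → EuclideanSpace ℝ (Fin p))) :
    μ {ω | (fun i => X i ω) ∈ s} ≤ gaussSample n p s := by
  rw [← h.map_eq]
  exact Measure.le_map_apply h.aemeasurable s

lemma ae_eventually_maronnaClose {Ω : Type*} [MeasurableSpace Ω] {μ : Measure Ω}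
    [IsProbabilityMeasure μ] {p : ℕ → ℕ}
    {X : (n : ℕ) → Fin n → Ω → EuclideanSpace ℝ (Fin (p n))}
    (hp : Tendsto (fun n : ℕ => (p n : ℝ) / (n : ℝ)) atTop (𝓝 y))
    (hX : ∀ n, IsGaussianSample μ (X n)) {C c ε δ : ℝ} (hc : 0 < c) (hε : 0 < ε) (hδ : 0 < δ)
    (H : ∀ n p : ℕ, 0 < n → |(p : ℝ) / (n : ℝ) - y| ≤ δ →
      gaussSample n p {X | ¬ MaronnaClose u y ε X} ≤
        ENNReal.ofReal (C * (n : ℝ) * Real.exp (-c * ε ^ 2 * (n : ℝ)))) :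
    ∀ᵐ ω ∂μ, ∀ᶠ n in atTop, MaronnaClose u y ε (fun i => X n i ω) := by
  have hev : ∀ᶠ n : ℕ in atTop, 0 < n ∧ |(p n : ℝ) / n - y| ≤ δ := by
    refine (eventually_gt_atTop 0).and ?_
    filter_upwards [Metric.tendsto_nhds.1 hp δ hδ] with n hn
    rw [Real.dist_eq] at hn
    exact hn.le
  obtain ⟨N, hN⟩ := eventually_atTop.1 hev
  have hsum : Summable fun n : ℕ => C * (n : ℝ) * Real.exp (-c * ε ^ 2 * (n : ℝ)) := by
    have h1 := (Real.summable_pow_mul_exp_neg_nat_mul 1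
      (by positivity : 0 < c * ε ^ 2)).mul_left C
    refine h1.congr fun n => ?_
    rw [pow_one, ← mul_assoc]
    congr 2
    ring
  have hfin : ∑' n, μ {ω | N ≤ n ∧ ¬ MaronnaClose u y ε (fun i => X n i ω)} ≠ ⊤ := by
    refine ne_top_of_le_ne_top hsum.tsum_ofReal_ne_top (ENNReal.tsum_le_tsum fun n => ?_)
    by_cases hn : N ≤ n
    · refine le_trans (measure_mono fun ω hω => ?_) (((hX n).measure_le
        {X | ¬ MaronnaClose u y ε X}).trans (H n (p n) (hN n hn).1 (hN n hn).2))
      exact hω.2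
    · simp [hn]
  -- This half of Borel–Cantelli needs no independence between different `n`.
  have h0 := measure_setOfPred_frequently_eq_zero hfin
  rw [← compl_mem_ae_iff] at h0
  filter_upwards [h0] with ω hω
  simp only [mem_compl_iff, mem_ofPred_eq, not_frequently] at hω
  filter_upwards [hω, eventually_ge_atTop N] with n h1 h2
  by_contra h3
  exact h1 ⟨h2, h3⟩

end Rate

theorem mainTheorem5 (u : ℝ → ℝ) (y : ℝ) (hy0 : 0 < y) (hy1 : y < 1)
    (hA1 : AssumptionA1 u y) (hA2 : AssumptionA2 u) :
    -- almost sure convergence along any array with `p / n → y`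
    (∀ (Ω : Type*) [MeasurableSpace Ω] (μ : Measure Ω) [IsProbabilityMeasure μ] (p : ℕ → ℕ)
        (X : (n : ℕ) → Fin n → Ω → EuclideanSpace ℝ (Fin (p n))),
        Tendsto (fun n : ℕ => (p n : ℝ) / (n : ℝ)) atTop (𝓝 y) →
        (∀ n, IsGaussianSample μ (X n)) →
        ∀ᵐ ω ∂μ,
          (∀ᶠ n in atTop, ∃! S, IsMaronnaSolution u (fun i => X n i ω) S) ∧
          Tendsto (fun n => maronnaError u y (fun i => X n i ω)) atTop (𝓝 0)) ∧
    -- the probability bound, on the event that the estimator exists and is unique; the bound is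
    -- on the (outer) measure of the complementary event
    (∃ C c c' : ℝ, 0 < C ∧ 0 < c ∧ 0 < c' ∧ ∀ ε : ℝ, 0 < ε → ε < c' →
      ∃ δ : ℝ, 0 < δ ∧ ∀ n p : ℕ, 0 < n → |(p : ℝ) / (n : ℝ) - y| ≤ δ →
        ∀ (Ω : Type*) [MeasurableSpace Ω] (μ : Measure Ω) [IsProbabilityMeasure μ]
          (X : Fin n → Ω → EuclideanSpace ℝ (Fin p)), IsGaussianSample μ X →
          μ {ω | (∃! S, IsMaronnaSolution u (fun i => X i ω) S) ∧
              maronnaError u y (fun i => X i ω) ≤ ε}ᶜ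
            ≤ ENNReal.ofReal (C * (n : ℝ) * Real.exp (-c * ε ^ 2 * (n : ℝ)))) := by
  obtain ⟨C, c, c', hC, hc, hc', H⟩ := exists_gaussSample_rate hy0 hy1 hA1 hA2
  refine ⟨?_, C, c, c', hC, hc, hc', fun ε hε hεc => ?_⟩
  · intro Ω _ μ _ p X hp hX
    -- A countable sequence of tolerances tending to 0; the shift by 2 keeps them strictly below
    -- `c'` from `k = 0` on.
    have hk : ∀ k : ℕ, ∀ᵐ ω ∂μ, ∀ᶠ n in atTop,
        MaronnaClose u y (c' / (k + 2)) (fun i => X n i ω) := fun k => by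
      have hε : 0 < c' / ((k : ℝ) + 2) := by positivity
      obtain ⟨δ, hδ, hH⟩ := H _ hε (div_lt_self hc' (by linarith [Nat.cast_nonneg (α := ℝ) k]))
      exact ae_eventually_maronnaClose hp hX hc hε hδ hH
    filter_upwards [ae_all_iff.2 hk] with ω hω
    refine ⟨(hω 0).mono fun n hn => hn.1, ?_⟩
    rw [Metric.tendsto_nhds]
    intro ε hε
    obtain ⟨k, hk⟩ := exists_nat_gt (c' / ε)
    filter_upwards [hω k] with n hn
    have h0 : 0 ≤ maronnaError u y (fun i => X n i ω) := norm_nonneg _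
    rw [Real.dist_eq, sub_zero, abs_of_nonneg h0]
    refine hn.2.trans_lt ?_
    rw [div_lt_iff₀ hε] at hk
    rw [div_lt_iff₀ (by positivity)]
    linarith
  · obtain ⟨δ, hδ, hH⟩ := H ε hε hεc
    refine ⟨δ, hδ, fun n p hn hp Ω _ μ _ X hX => ?_⟩
    exact (hX.measure_le {X | ¬ MaronnaClose u y ε X}).trans (hH n p hn hp)
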